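/- **Setting.** Let $q,d\in\mathbb C^\times$ satisfy $q^nd^m\neq 1$ for all $(n,m)\in\mathbb Z^2\setminus\{(0,0)\}$, and put $q_1=q^{-1}d$, $q_2=q^2$, $q_3=q^{-1}d^{-1}$. Let $\alpha_{i,n}$ ($i=1,2$, $n\in\mathbb Z\setminus\{0\}$) satisfy $[\alpha_{i,n},\alpha_{i,m}]=n(1+q_2^{-|n|})\delta_{n+m,0}$ and $[\alpha_{i,n},\alpha_{j,m}]=-n(q_1^{|n|}+q_3^{|n|})\delta_{n+m,0}$ for $i\ne j$. For $u\in\mathbb C$ let $\mathcal F_u=\bigoplus_{n\in\mathbb Z}\mathbb C[\alpha_{1,-1},\alpha_{1,-2},\dots,\alpha_{2,-1},\alpha_{2,-2},\dots]\,|n,u\rangle$ be the Fock module in which $\alpha_{i,k}|n,u\rangle=0$ for $k>0$, $\alpha_{1,0}=-\alpha_{2,0}$ acts on the $n$-th summand by $n$, $\mathsf a_0$ acts by $u$, and $e^{\frac12\chi_1}=e^{-\frac12\chi_2}$ maps $|n,u\rangle$ to $|n+1,u\rangle$ and commutes with all $\alpha_{i,k}$, $k\neq0$. On $\mathcal F_{u_1}\otimes\mathcal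 F_{u_2}$ put, for $n\ne0$, $$\bar h_{i,n}=-\frac{1-q_2^n}{n(q-q^{-1})}\left(\alpha_{i,n}\otimes1+q^{|n|}\,1\otimes\alpha_{i,n}\right),\qquad b_{i,n}=\alpha_{i,n}\otimes 1-\frac{[\alpha_{i,n}\otimes1,\bar h_{i,-n}]}{[\bar h_{i,n},\bar h_{i,-n}]}\,\bar h_{i,n},$$ and $b_{i,0}=\frac12(\alpha_{i,0}\otimes1-1\otimes\alpha_{i,0})$, $Q_i=\frac12(\chi_i\otimes1-1\otimes\chi_i)$, $\zeta=\frac12(\mathsf a_0\otimes1-1\otimes\mathsf a_0-1\otimes1)$. Let $$\Lambda_i^+(z)={:}\exp\Big(-\sum_{n\ne0}\tfrac{q^n}{n}b_{i,n}z^{-n}\Big){:}\;e^{Q_i}(q^{-1}z)^{b_{i,0}}q_1^{\zeta},\qquad \Lambda_i^-(z)={:}\exp\Big(\sum_{n\ne0}\tfrac{q^{-n}}{n}b_{i,n}z^{-n}\Big){:}\;e^{-Q_i}(qz)^{-b_{i,0}}q_1^{-\zeta},$$ where normal ordering places the modes of negative index to the left of those of positive index and $e^{\pm Q_i}$ to the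 left of functions of $b_{i,0}$. For $\xi\in\mathbb C^\times$ put $T(\xi;z)=M_1(\xi;z)+M_2(\xi;z)+z^2M_3(\xi;z)+z^2M_4(\xi;z)$ with $$M_1=q\,{:}\Lambda^+_1(\xi z)\Lambda^+_2(z){:},\quad M_2=q^{-1}\,{:}\Lambda^-_1(\xi z)\Lambda^-_2(z){:},$$ $$M_3=q(1-q_1\xi)(1-q_3\xi)\,{:}\Lambda^+_1(\xi z)\Lambda^-_2(z){:},\quad M_4=q^{-1}(1-q_1^{-1}\xi)(1-q_3^{-1}\xi)\,{:}\Lambda^-_1(\xi z)\Lambda^+_2(z){:}.$$ Complex powers of $q,q_1,\xi$ are taken with respect to arbitrary fixed values of their logarithms. Only integral powers of $z$ occur in $T(\xi;z)$. Let $\delta(z)=\sum_{n\in\mathbb Z}z^n$. **Theorem.** For both choices of the sign (the same throughout each formula), as formal series in $z^{\pm1},w^{\pm1}$ of operators on $\mathcal F_{u_1}\otimes\mathcal F_{u_2}$ (on each vector, every coefficient on the left-hand side is given by sums with finitely many nonzero terms), $$g^{(k)}\!\left(\tfrac wz\right)T(q_k^{\pm1};z)T(q_k^{\pm1};w)-g^{(k)}\!\left(\tfrac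 zw\right)T(q_k^{\pm1};w)T(q_k^{\pm1};z)=C^{(k)}\left(\delta\!\left(\tfrac{w}{q_2z}\right)-\delta\!\left(\tfrac{q_2w}{z}\right)\right)\qquad(k=1,3),$$ where $$g^{(1)}(z)=\exp\Big(\sum_{n>0}\frac{(1-q_1^{2n})(1-q_3^n/q_1^n)}{n(1+q_2^{-n})}z^n\Big),\qquad g^{(3)}(z)=\exp\Big(\sum_{n>0}\frac{(1-q_3^{2n})(1-q_1^n/q_3^n)}{n(1+q_2^{-n})}z^n\Big),$$ $$C^{(1)}=-\frac{(1-q_1^2)(1-q_3/q_1)}{1-q_2^{-1}},\qquad C^{(3)}=-\frac{(1-q_3^2)(1-q_1/q_3)}{1-q_2^{-1}}.$$ Moreover, only three of the four terms occur in these operators: $T(q_k;z)=M_1(q_k;z)+M_2(q_k;z)+z^2M_3(q_k;z)$ and $T(q_k^{-1};z)=M_1(q_k^{-1};z)+M_2(q_k^{-1};z)+z^2M_4(q_k^{-1};z)$ for $k=1,3$. -/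

import Mathlib

noncomputable section

namespace FreeField

/-! ## Formal exponentials and delta functions -/

/-- For a sequence `x 1, x 2, …` in a (possibly noncommutative) `ℂ`-algebra, the formal power series
`exp (∑_{n ≥ 1} x n X ^ n) = ∑_m (1 / m!) (∑_{n ≥ 1} x n X ^ n) ^ m`. The exponent has no constant
term, so only `m ≤ k` contributes to the coefficient of `X ^ k`. The value `x 0` is ignored. -/
def expSeries {A : Type*} [Ring A] [Algebra ℂ A] (x : ℕ → A) : PowerSeries A :=
  PowerSeries.mk fun k => ∑ m ∈ Finset.range (k + 1), ((m.factorial : ℂ)⁻¹) •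
    PowerSeries.coeff k ((PowerSeries.mk fun n => if n = 0 then 0 else x n) ^ m)

/-- The coefficient of `z ^ (-m) w ^ (-n)` in `δ (c w / z) = ∑_{k ∈ ℤ} c ^ k w ^ k z ^ (-k)`. -/
def deltaCoeff (c : ℂ) (m n : ℤ) : ℂ := if m + n = 0 then c ^ m else 0

/-! ## Parameters -/

/-- The complex parameters: `q`, `d`, the spectral parameters `u₁`, `u₂` of the two Fock modules,
and the values of `log q` and `log q₁` that are used to define complex powers of `q` and `q₁`. -/
structure Params where
  q : ℂ
  d : ℂ
  logq : ℂ
  logq₁ : ℂ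
  u₁ : ℂ
  u₂ : ℂ

namespace Params

variable (p : Params)

def q₁ : ℂ := p.q⁻¹ * p.d
def q₂ : ℂ := p.q ^ 2
def q₃ : ℂ := p.q⁻¹ * p.d⁻¹

/-- The standing assumptions: `q`, `d` are nonzero, `q ^ n d ^ m ≠ 1` unless `n = m = 0`,
and `logq`, `logq₁` are logarithms (any branch) of `q` and `q₁`. -/
structure Admissible : Prop where
  q_ne_zero : p.q ≠ 0
  d_ne_zero : p.d ≠ 0
  generic : ∀ n m : ℤ, (n ≠ 0 ∨ m ≠ 0) → p.q ^ n * p.d ^ m ≠ 1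
  exp_logq : Complex.exp p.logq = p.q
  exp_logq₁ : Complex.exp p.logq₁ = p.q₁

/-- The scalar `[α_{i,n}, α_{j,-n}]`. -/
def heis (i j : Fin 2) (n : ℤ) : ℂ :=
  if i = j then n * (1 + p.q₂⁻¹ ^ n.natAbs) else -(n * (p.q₁ ^ n.natAbs + p.q₃ ^ n.natAbs))

end Params

/-! ## The tensor product of two Fock modules

The colours `i = 1, 2` are `0, 1 : Fin 2`. The two tensor factors are also indexed by `Fin 2`.
The space `F_{u₁} ⊗ F_{u₂}` is the direct sum over `(n₁, n₂) ∈ ℤ × ℤ` of the spaces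
`ℂ[α_{i,-n} ⊗ 1, 1 ⊗ α_{i,-n} : i = 1, 2, n ≥ 1] (|n₁, u₁⟩ ⊗ |n₂, u₂⟩)`. -/

/-- The polynomial ring in the creation operators of both factors. The variable `(a, i, k)` is the
creation operator `α_{i,-(k+1)}` in the tensor factor `a`. -/
abbrev Osc : Type := MvPolynomial (Fin 2 × Fin 2 × ℕ) ℂ

/-- `F_{u₁} ⊗ F_{u₂}`: a vector assigns to every `(n₁, n₂)` its component in
`F(n₁, u₁) ⊗ F(n₂, u₂)`. -/
abbrev Fock : Type := (ℤ × ℤ) →₀ Osc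

variable (p : Params)

/-- The oscillator `α_{i,n}` (`n ≠ 0`) acting on the tensor factor `a`: for `n < 0` the
multiplication by the corresponding variable, for `n > 0` the derivation with
`[α_{i,n}, α_{j,-m}] = δ_{n,m} heis i j n` that kills the vacuum and commutes with the oscillators of
the other factor. (For `n = 0` the value is `0`; the zero modes are treated separately below.) -/
def alpha (a i : Fin 2) : ℤ → Module.End ℂ Osc
  | Int.ofNat 0 => 0
  | Int.ofNat (k + 1) => ∑ j : Fin 2, p.heis i j (k + 1) • (MvPolynomial.pderiv (a, j, k)).toLinearMap
  | Int.negSucc k => LinearMap.mulLeft ℂ (MvPolynomial.X (a, i, k))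

/-- The scalar `- (1 - q₂ ^ n) / (n (q - q⁻¹))` that multiplies `α_{i,n}` in the Cartan mode
`H_{i,n}`. -/
def cartanScalar (n : ℤ) : ℂ := -((1 - p.q₂ ^ n) / (n * (p.q - p.q⁻¹)))

/-- The Cartan mode `h̄_{i,n}` (`n ≠ 0`) on `F_{u₁} ⊗ F_{u₂}`, the image of
`H_{i,n}` under the coproduct. -/
def cartan (i : Fin 2) (n : ℤ) : Module.End ℂ Osc :=
  cartanScalar p n • (alpha p 0 i n + p.q ^ n.natAbs • alpha p 1 i n)

/-- The scalar `[α_{i,n} ⊗ 1, h̄_{i,-n}]`. -/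
def alphaCartanBracket (i : Fin 2) (n : ℤ) : ℂ := cartanScalar p (-n) * p.heis i i n

/-- The scalar `[h̄_{i,n}, h̄_{i,-n}]`. -/
def cartanBracket (i : Fin 2) (n : ℤ) : ℂ :=
  cartanScalar p n * cartanScalar p (-n) * ((1 + p.q ^ n.natAbs * p.q ^ n.natAbs) * p.heis i i n)

/-- The boson `b_{i,n}` (`n ≠ 0`) that remains after decoupling the Cartan modes:
`α_{i,n} ⊗ 1 - ([α_{i,n} ⊗ 1, h̄_{i,-n}] / [h̄_{i,n}, h̄_{i,-n}]) h̄_{i,n}`. -/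
def boson (i : Fin 2) (n : ℤ) : Module.End ℂ Osc :=
  alpha p 0 i n - (alphaCartanBracket p i n / cartanBracket p i n) • cartan p i n

/-- The eigenvalue of the zero mode `b_{i,0} = (α_{i,0} ⊗ 1 - 1 ⊗ α_{i,0}) / 2` on
`F(n₁, u₁) ⊗ F(n₂, u₂)`, where `α_{1,0} = - α_{2,0}` acts on `F(n, u)` by `n`. -/
def bosonZero (i : Fin 2) (n : ℤ × ℤ) : ℚ :=
  if i = 0 then ((n.1 : ℚ) - n.2) / 2 else -(((n.1 : ℚ) - n.2) / 2)

/-- The eigenvalue of `ζ = (a₀ ⊗ 1 - 1 ⊗ a₀ - 1 ⊗ 1) / 2` on `F_{u₁} ⊗ F_{u₂}`, where `a₀` acts on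
`F_u` by `u`. -/
def zetaZero : ℂ := (p.u₁ - p.u₂ - 1) / 2

/-! ## Normally ordered exponentials -/

/-- A linear expression in the bosons,
`∑_i (charge i • Q_i + (logz i • log z + const i) b_{i,0}) + zeta • ζ
  + ∑_i ∑_{n ≠ 0} osc i n • b_{i,n} z ^ (-n)`,
where `Q_i = (χ_i ⊗ 1 - 1 ⊗ χ_i) / 2` is conjugate to `b_{i,0}`. -/
@[ext] structure LinField where
  charge : Fin 2 → ℤ
  logz : Fin 2 → ℤ
  const : Fin 2 → ℂ
  zeta : ℂ
  osc : Fin 2 → ℤ → ℂ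

namespace LinField

instance : Add LinField where
  add φ ψ :=
    { charge := φ.charge + ψ.charge
      logz := φ.logz + ψ.logz
      const := φ.const + ψ.const
      zeta := φ.zeta + ψ.zeta
      osc := φ.osc + ψ.osc }

/-- The substitution `z ↦ ξ z` with `ξ = exp L`, `log (ξ z) = log z + L`. -/
def rescale (L : ℂ) (φ : LinField) : LinField where
  charge := φ.charge
  logz := φ.logz
  const i := φ.const i + φ.logz i * L
  zeta := φ.zeta
  osc i n := φ.osc i n * Complex.exp L ^ (-n)

/-- `exp (∑_{n > 0} ∑_i osc i (-n) b_{i,-n} z ^ n)`, a power series in `z`. -/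
def creation (φ : LinField) : PowerSeries (Module.End ℂ Osc) :=
  expSeries fun n => ∑ i : Fin 2, φ.osc i (-(n : ℤ)) • boson p i (-(n : ℤ))

/-- `exp (∑_{n > 0} ∑_i osc i n b_{i,n} z ^ (-n))`, a power series in `z ^ (-1)`. -/
def annihilation (φ : LinField) : PowerSeries (Module.End ℂ Osc) :=
  expSeries fun n => ∑ i : Fin 2, φ.osc i (n : ℤ) • boson p i (n : ℤ)

end LinField

/-! The coefficients of `annihilation` are locally nilpotent: each vector is killed by all but
finitely many of them. This makes the modes of a normally ordered exponential well defined. -/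

/-- The degree of a monomial, where `α_{i,-n}` has degree `n`. -/
def oscWeight (s : (Fin 2 × Fin 2 × ℕ) →₀ ℕ) : ℕ :=
  Finsupp.weight (fun x : Fin 2 × Fin 2 × ℕ => x.2.2 + 1) s

/-- The span of all monomials of degree less than `N`. -/
def oscFilt (N : ℕ) : Submodule ℂ Osc :=
  Submodule.span ℂ {f | ∃ s, oscWeight s < N ∧ f = MvPolynomial.monomial s 1}

theorem oscFilt_zero : oscFilt 0 = ⊥ := by
  simp [oscFilt]

theorem oscFilt_mono {M N : ℕ} (h : M ≤ N) : oscFilt M ≤ oscFilt N := by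
  apply Submodule.span_mono
  rintro f ⟨s, hs, rfl⟩
  exact ⟨s, lt_of_lt_of_le hs h, rfl⟩

theorem exists_mem_oscFilt (v : Osc) : ∃ N, v ∈ oscFilt N := by
  induction v using MvPolynomial.induction_on' with
  | monomial s a =>
    refine ⟨oscWeight s + 1, ?_⟩
    have : (MvPolynomial.monomial s a : Osc) = a • MvPolynomial.monomial s 1 := by
      rw [MvPolynomial.smul_monomial]; simp
    rw [this]
    exact Submodule.smul_mem _ _ (Submodule.subset_span ⟨s, Nat.lt_succ_self _, rfl⟩)
  | add f g hf hg =>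
    obtain ⟨M, hM⟩ := hf
    obtain ⟨N, hN⟩ := hg
    exact ⟨max M N, Submodule.add_mem _ (oscFilt_mono (le_max_left _ _) hM)
      (oscFilt_mono (le_max_right _ _) hN)⟩

/-- An operator that lowers the degree by at least `m`. -/
def Lowers (m : ℕ) (A : Module.End ℂ Osc) : Prop :=
  ∀ N, ∀ v ∈ oscFilt N, A v ∈ oscFilt (N - m)

theorem Lowers.smul {m : ℕ} {A : Module.End ℂ Osc} (h : Lowers m A) (c : ℂ) : Lowers m (c • A) :=
  fun N v hv => Submodule.smul_mem _ c (h N v hv)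

theorem Lowers.add {m : ℕ} {A B : Module.End ℂ Osc} (h : Lowers m A) (h' : Lowers m B) :
    Lowers m (A + B) :=
  fun N v hv => Submodule.add_mem _ (h N v hv) (h' N v hv)

theorem Lowers.zero (m : ℕ) : Lowers m 0 := fun _ _ _ => Submodule.zero_mem _

theorem Lowers.sum {m : ℕ} {ι : Type} (s : Finset ι) (A : ι → Module.End ℂ Osc)
    (h : ∀ i ∈ s, Lowers m (A i)) : Lowers m (∑ i ∈ s, A i) := by
  classical
  induction s using Finset.induction_on with
  | empty => simpa using Lowers.zero m
  | insert a s ha ih =>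
    rw [Finset.sum_insert ha]
    exact (h a (by simp)).add (ih fun i hi => h i (by simp [hi]))

theorem Lowers.mul {m n : ℕ} {A B : Module.End ℂ Osc} (h : Lowers m A) (h' : Lowers n B) :
    Lowers (m + n) (A * B) := by
  intro N v hv
  have := h _ _ (h' N v hv)
  rwa [Nat.sub_sub, add_comm n m] at this

theorem lowers_pderiv (a j : Fin 2) (k : ℕ) :
    Lowers (k + 1) (MvPolynomial.pderiv (R := ℂ) (a, j, k)).toLinearMap := by
  intro N v hv
  induction hv using Submodule.span_induction with
  | zero => simp
  | add f g _ _ hf hg => rw [map_add]; exact Submodule.add_mem _ hf hg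
  | smul c f _ hf => rw [map_smul]; exact Submodule.smul_mem _ c hf
  | mem f hf =>
    obtain ⟨s, hs, rfl⟩ := hf
    by_cases h0 : s (a, j, k) = 0
    · simp [MvPolynomial.pderiv_monomial, h0]
    · have hw := Finsupp.weight_sub_single_add
        (w := fun x : Fin 2 × Fin 2 × ℕ => x.2.2 + 1) h0
      have hlt : oscWeight (s - Finsupp.single (a, j, k) 1) < N - (k + 1) := by
        simp only [oscWeight] at hs ⊢
        simp only at hw
        omega
      have : (MvPolynomial.pderiv (R := ℂ) (a, j, k)).toLinearMap (MvPolynomial.monomial s 1)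
          = (s (a, j, k) : ℂ) •
            MvPolynomial.monomial (s - Finsupp.single (a, j, k) 1) (1 : ℂ) := by
        simp [MvPolynomial.pderiv_monomial, MvPolynomial.smul_monomial]
      rw [this]
      exact Submodule.smul_mem _ _ (Submodule.subset_span ⟨_, hlt, rfl⟩)

theorem lowers_alpha (a i : Fin 2) (k : ℕ) : Lowers k (alpha p a i (k : ℤ)) := by
  cases k with
  | zero => exact Lowers.zero 0
  | succ k => exact Lowers.sum _ _ fun j _ => (lowers_pderiv a j k).smul _

theorem lowers_boson (i : Fin 2) (k : ℕ) : Lowers k (boson p i (k : ℤ)) := by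
  have h : boson p i (k : ℤ) = alpha p 0 i k +
      (-(alphaCartanBracket p i k / cartanBracket p i k)) • cartan p i k := by
    rw [boson, sub_eq_add_neg]
    congr 1
    exact (neg_smul _ _).symm
  rw [h]
  exact (lowers_alpha p 0 i k).add
    ((((lowers_alpha p 0 i k).add ((lowers_alpha p 1 i k).smul _)).smul _).smul _)

theorem lowers_expSeries (x : ℕ → Module.End ℂ Osc) (hx : ∀ k, Lowers k (x k)) (k : ℕ) :
    Lowers k (PowerSeries.coeff k (expSeries x)) := by
  have key : ∀ m k : ℕ, Lowers k (PowerSeries.coeff k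
      ((PowerSeries.mk fun n => if n = 0 then 0 else x n) ^ m)) := by
    intro m
    induction m with
    | zero =>
      intro k
      rw [pow_zero, PowerSeries.coeff_one]
      split_ifs with h
      · subst h; intro N v hv; simpa using hv
      · exact Lowers.zero k
    | succ m ih =>
      intro k
      rw [pow_succ, PowerSeries.coeff_mul]
      refine Lowers.sum _ _ fun ij hij => ?_
      rw [← Finset.HasAntidiagonal.mem_antidiagonal.mp hij]
      refine (ih _).mul ?_
      rw [PowerSeries.coeff_mk]
      split_ifs
      · exact Lowers.zero _
      · exact hx _
  rw [expSeries, PowerSeries.coeff_mk]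
  exact Lowers.sum _ _ fun m _ => (key m k).smul _

namespace LinField

theorem annihilation_eventually_zero (φ : LinField) (v : Osc) :
    ∃ N, ∀ m, N ≤ m → PowerSeries.coeff m (φ.annihilation p) v = 0 := by
  obtain ⟨N, hN⟩ := exists_mem_oscFilt v
  refine ⟨N, fun m hm => ?_⟩
  have := lowers_expSeries (fun n => ∑ i : Fin 2, φ.osc i (n : ℤ) • boson p i (n : ℤ))
    (fun k => Lowers.sum _ _ fun i _ => (lowers_boson p i k).smul _) m N v hN
  rw [Nat.sub_eq_zero_of_le hm, oscFilt_zero] at this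
  exact (Submodule.mem_bot ℂ).mp this

/-- The `m`-th term of the coefficient of `z ^ k` in the product of `creation` and `annihilation`:
the coefficient of `z ^ (m + k)` in the first after that of `z ^ (-m)` in the second. -/
def oscTerm (φ : LinField) (k : ℤ) (m : ℕ) : Module.End ℂ Osc :=
  if 0 ≤ m + k then
    PowerSeries.coeff (m + k).toNat (φ.creation p) * PowerSeries.coeff m (φ.annihilation p)
  else 0

theorem finite_support_oscTerm (φ : LinField) (k : ℤ) (v : Osc) :
    (Function.support fun m : ℕ => φ.oscTerm p k m v).Finite := by
  obtain ⟨N, hN⟩ := φ.annihilation_eventually_zero p v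
  refine (Set.finite_Iio N).subset fun m hm => ?_
  by_contra h
  refine hm ?_
  simp only [oscTerm]
  split_ifs
  · rw [Module.End.mul_apply, hN m (not_lt.mp h), map_zero]
  · rfl

/-- The coefficient of `z ^ k` in
`exp (∑_{n > 0} ∑_i osc i (-n) b_{i,-n} z ^ n) exp (∑_{n > 0} ∑_i osc i n b_{i,n} z ^ (-n))`. -/
def oscMode (φ : LinField) (k : ℤ) : Module.End ℂ Osc where
  toFun v := ∑ᶠ m : ℕ, φ.oscTerm p k m v
  map_add' v w := by
    simp only [map_add]
    exact finsum_add_distrib (φ.finite_support_oscTerm p k v) (φ.finite_support_oscTerm p k w)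
  map_smul' c v := by
    simp only [map_smul, RingHom.id_apply]
    exact (smul_finsum c _).symm

/-- The exponent of `z` in `z ^ (∑_i logz i • b_{i,0})` on the sector `(n₁, n₂)`. -/
def zExponent (φ : LinField) (n : ℤ × ℤ) : ℚ := ∑ i : Fin 2, φ.logz i * bosonZero i n

/-- The scalar by which `exp (∑_i const i • b_{i,0} + zeta • ζ)` acts on the sector `(n₁, n₂)`. -/
def zeroScalar (φ : LinField) (n : ℤ × ℤ) : ℂ :=
  Complex.exp (∑ i : Fin 2, φ.const i * (bosonZero i n : ℂ) + φ.zeta * zetaZero p)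

/-- The action of `exp (∑_i charge i • Q_i)` on the sectors. One has `Q_2 = - Q_1`, and
`exp Q_1 (|n₁, u₁⟩ ⊗ |n₂, u₂⟩) = |n₁ + 1, u₁⟩ ⊗ |n₂ - 1, u₂⟩`. -/
def shift (φ : LinField) (n : ℤ × ℤ) : ℤ × ℤ :=
  (n.1 + (φ.charge 0 - φ.charge 1), n.2 - (φ.charge 0 - φ.charge 1))

/-- The coefficient of `z ^ e` (`e ∈ ℚ`) in the normally ordered exponential `:exp φ:`, in which
creation operators stand to the left of annihilation operators and `exp Q_i` to the left of the
functions of `b_{i,0}`. -/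
def normalExp (φ : LinField) (e : ℚ) : Module.End ℂ Fock :=
  Finsupp.lsum ℂ fun n : ℤ × ℤ =>
    if Int.fract (e - φ.zExponent n) = 0 then
      φ.zeroScalar p n • (Finsupp.lsingle (φ.shift n) ∘ₗ φ.oscMode p ⌊e - φ.zExponent n⌋)
    else 0

end LinField

/-! ## The operators `Λ^±_i(z)` and `T_{ij}(ξ; z)`

The normally ordered product of two normally ordered exponentials is
`: (:exp φ:) (:exp ψ:) : = :exp (φ + ψ):`. -/

/-- The exponent of
`Λ^+_i(z) = :exp (- ∑_{n ≠ 0} (q ^ n / n) b_{i,n} z ^ (-n)): exp Q_i (q⁻¹ z) ^ b_{i,0} q₁ ^ ζ`. -/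
def lambdaPlus (i : Fin 2) : LinField where
  charge := Pi.single i 1
  logz := Pi.single i 1
  const := Pi.single i (-p.logq)
  zeta := p.logq₁
  osc j n := if j = i then -(p.q ^ n / n) else 0

/-- The exponent of
`Λ^-_i(z) = :exp (∑_{n ≠ 0} (q ^ (-n) / n) b_{i,n} z ^ (-n)): exp (-Q_i) (q z) ^ (-b_{i,0}) q₁ ^ (-ζ)`.
-/
def lambdaMinus (i : Fin 2) : LinField where
  charge := Pi.single i (-1)
  logz := Pi.single i (-1)
  const := Pi.single i (-p.logq)
  zeta := -p.logq₁
  osc j n := if j = i then p.q ^ (-n) / n else 0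

/-- The coefficient of `z ^ e` in `M^(1)_{ij}(ξ; z) = q :Λ^+_i(ξ z) Λ^+_j(z):`, `ξ = exp L`. -/
def M₁ (L : ℂ) (i j : Fin 2) (e : ℚ) : Module.End ℂ Fock :=
  p.q • ((lambdaPlus p i).rescale L + lambdaPlus p j).normalExp p e

/-- The coefficient of `z ^ e` in `M^(2)_{ij}(ξ; z) = q⁻¹ :Λ^-_i(ξ z) Λ^-_j(z):`, `ξ = exp L`. -/
def M₂ (L : ℂ) (i j : Fin 2) (e : ℚ) : Module.End ℂ Fock :=
  p.q⁻¹ • ((lambdaMinus p i).rescale L + lambdaMinus p j).normalExp p e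

/-- The coefficient of `z ^ e` in
`M^(3)_{ij}(ξ; z) = q (1 - q₁ ξ) (1 - q₃ ξ) :Λ^+_i(ξ z) Λ^-_j(z):`, `ξ = exp L`. -/
def M₃ (L : ℂ) (i j : Fin 2) (e : ℚ) : Module.End ℂ Fock :=
  (p.q * (1 - p.q₁ * Complex.exp L) * (1 - p.q₃ * Complex.exp L)) •
    ((lambdaPlus p i).rescale L + lambdaMinus p j).normalExp p e

/-- The coefficient of `z ^ e` in
`M^(4)_{ij}(ξ; z) = q⁻¹ (1 - q₁⁻¹ ξ) (1 - q₃⁻¹ ξ) :Λ^-_i(ξ z) Λ^+_j(z):`, `ξ = exp L`. -/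
def M₄ (L : ℂ) (i j : Fin 2) (e : ℚ) : Module.End ℂ Fock :=
  (p.q⁻¹ * (1 - p.q₁⁻¹ * Complex.exp L) * (1 - p.q₃⁻¹ * Complex.exp L)) •
    ((lambdaMinus p i).rescale L + lambdaPlus p j).normalExp p e

/-- The coefficient of `z ^ e` in
`T_{ij}(ξ; z) = M^(1)_{ij}(ξ; z) + M^(2)_{ij}(ξ; z) + z² M^(3)_{ij}(ξ; z) + z² M^(4)_{ij}(ξ; z)`. -/
def TCoeff (L : ℂ) (i j : Fin 2) (e : ℚ) : Module.End ℂ Fock :=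
  M₁ p L i j e + M₂ p L i j e + M₃ p L i j (e - 2) + M₄ p L i j (e - 2)

/-- Only integral powers of `z` occur in `T(ξ; z) = T_{12}(ξ; z)`. -/
theorem TCoeff_eq_zero (L : ℂ) (e : ℚ) (he : Int.fract e ≠ 0) : TCoeff p L 0 1 e = 0 := by
  have key : ∀ (φ : LinField) (e : ℚ), Int.fract e ≠ 0 →
      (∀ n, ∃ c : ℤ, φ.zExponent n = c) → φ.normalExp p e = 0 := by
    intro φ e he h
    unfold LinField.normalExp
    ext n : 1
    obtain ⟨c, hc⟩ := h n
    have hf : Int.fract (e - φ.zExponent n) ≠ 0 := by rw [hc, Int.fract_sub_intCast]; exact he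
    refine LinearMap.ext fun v => ?_
    simp [hf]
  have he2 : Int.fract (e - 2) ≠ 0 := by
    have := Int.fract_sub_intCast e 2
    push_cast at this
    rwa [this]
  have hadd : ∀ (φ ψ : LinField) i, (φ + ψ).logz i = φ.logz i + ψ.logz i := fun _ _ _ => rfl
  unfold TCoeff M₁ M₂ M₃ M₄
  rw [key _ e he, key _ e he, key _ _ he2, key _ _ he2]
  · simp
  · intro n; refine ⟨-(n.1 - n.2), ?_⟩
    simp [LinField.zExponent, hadd, LinField.rescale, lambdaPlus, lambdaMinus, bosonZero]; ring
  · intro n; refine ⟨n.1 - n.2, ?_⟩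
    simp [LinField.zExponent, hadd, LinField.rescale, lambdaPlus, lambdaMinus, bosonZero]
  · intro n; refine ⟨0, ?_⟩
    simp [LinField.zExponent, hadd, LinField.rescale, lambdaMinus, bosonZero]
  · intro n; refine ⟨0, ?_⟩
    simp [LinField.zExponent, hadd, LinField.rescale, lambdaPlus, bosonZero]

/-- The mode `T_n` in the expansion `T(ξ; z) = T_{12}(ξ; z) = ∑_{n ∈ ℤ} T_n z ^ (-n)`,
`ξ = exp L`. -/
def TMode (L : ℂ) (n : ℤ) : Module.End ℂ Fock := TCoeff p L 0 1 (-n)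

/-! ## The quadratic relation -/

/-- `exp (∑_{n > 0} (1 - a ^ (2 n)) (1 - b ^ n / a ^ n) / (n (1 + q₂ ^ (-n))) X ^ n)`. -/
def structureSeries (a b : ℂ) : PowerSeries ℂ :=
  expSeries fun n => (1 - a ^ (2 * n)) * (1 - b ^ n / a ^ n) / (n * (1 + (p.q₂ ^ n)⁻¹))

/-- `- (1 - a²) (1 - b / a) / (1 - q₂⁻¹)`. -/
def structureConst (a b : ℂ) : ℂ := -((1 - a ^ 2) * (1 - b / a) / (1 - p.q₂⁻¹))

/-- For `T(z) = ∑_n T_n z ^ (-n)`, the relation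
`g(w/z) T(z) T(w) - g(z/w) T(w) T(z) = C (δ(w / (c z)) - δ(c w / z))`
of formal series in `z^{±1}, w^{±1}`: for all `m`, `n`, the coefficients of `z ^ (-m) w ^ (-n)` agree
on every vector `v`. The series for these coefficients on the left have only finitely many nonzero
terms when applied to `v`, which is part of the claim. -/
def QuadraticRelation (T : ℤ → Module.End ℂ Fock) (g : PowerSeries ℂ) (C c : ℂ) : Prop :=
  ∀ (m n : ℤ) (v : Fock),
    {l : ℕ | T (m - l) (T (n + l) v) ≠ 0}.Finite ∧
    {l : ℕ | T (n - l) (T (m + l) v) ≠ 0}.Finite ∧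
    (∑ᶠ l : ℕ, PowerSeries.coeff l g • T (m - l) (T (n + l) v)) -
        (∑ᶠ l : ℕ, PowerSeries.coeff l g • T (n - l) (T (m + l) v)) =
      (C * (deltaCoeff c⁻¹ m n - deltaCoeff c m n)) • v

end FreeField

end

open FreeField

/-! Write a for q_k, b for the other of q₁, q₃, and ξ = a^s with s = ±1. One of the factors in M₃ or
M₄ vanishes, so T is a sum of three vertex operators: A = M₁, B = M₂ and C, which is z² M₃ for s = 1
and z² M₄ for s = -1. Every product of two of them is a scalar factor times a normally ordered
product: X(z)Y(w) = τ z^ρ S(w/z) :X(z)Y(w):, where S is the exponential of the oscillator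
contractions and τ z^ρ comes from the zero modes (`VertexData.mode_mode`). Normal ordering is
symmetric, so the relation is a statement about the nine scalar functions g·S.

The bosons satisfy [b_{i,n}, b_{i,-n}] = n, while brackets of different colours carry the
denominator 1 + q₂^{-n}. The exponent of g has the same denominator. Since q₂ab = 1, it cancels in
every g·S (`contractionSum_same` and its companions), and with x = w/z these become rational
functions. For AA and BB, g·S = 1 and nothing remains. For CC, g·S is a palindromic polynomial of
degree 4 and ρ = 4, so z⁴(g·S)(w/z) is symmetric in z, w and nothing remains
(`VertexData.defect_self`). For A or B with C, the two orders give one rational function expanded at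
x = 0 and at x = ∞, with the single pole x = 1. The difference is a multiple of δ(w/z), and it
cancels against the contribution with the two operators interchanged. For A with B there is a second
pole x = q₂⁻¹. The part at x = 1 cancels as before, leaving a multiple of δ(q₂w/z) and its mirror
image (`VertexData.defect_add_defect`, `two_poles_delta`). On z = q₂w the oscillators and the zero
modes of A and B cancel, so :A(z)B(w): is the identity there (`finsum_normalPair_inverse`). This is
the right-hand side.

Formal convergence is controlled by degree: a vector of degree less than N is killed by all
annihilation coefficients of index at least N. Normal products can therefore be cut off at N, after
which they may be multiplied by arbitrary two-sided series in w/z. Identities between formal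
exponentials are proved by uniqueness for the differential equation X G' = t G (`euler_ext`). -/

noncomputable section

namespace FreeField

/-! ## The Euler operator on formal power series -/

section Euler

set_option linter.unusedSectionVars false

variable {A : Type*} [Ring A] [Algebra ℂ A]

/-- The Euler operator `X d/dX`. -/
def euler (f : PowerSeries A) : PowerSeries A :=
  PowerSeries.mk fun n => (n : ℂ) • PowerSeries.coeff n f

theorem coeff_euler (f : PowerSeries A) (n : ℕ) :
    PowerSeries.coeff n (euler f) = (n : ℂ) • PowerSeries.coeff n f :=
  PowerSeries.coeff_mk _ _

theorem euler_mul (f g : PowerSeries A) : euler (f * g) = euler f * g + f * euler g := by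
  ext n
  simp only [coeff_euler, map_add, PowerSeries.coeff_mul, Finset.smul_sum,
    ← Finset.sum_add_distrib, smul_mul_assoc, mul_smul_comm, ← add_smul]
  refine Finset.sum_congr rfl fun ij hij => ?_
  rw [← Finset.HasAntidiagonal.mem_antidiagonal.mp hij, Nat.cast_add]

theorem euler_one : euler (1 : PowerSeries A) = 0 := by
  ext n
  rw [coeff_euler, PowerSeries.coeff_one]
  split_ifs with h <;> simp [h]

theorem euler_C (x : A) : euler (PowerSeries.C x) = 0 := by
  ext n
  rw [coeff_euler, PowerSeries.coeff_C]
  split_ifs with h <;> simp [h]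

theorem euler_pow {f : PowerSeries A} (h : Commute f (euler f)) (m : ℕ) :
    euler (f ^ (m + 1)) = (m + 1) • (euler f * f ^ m) := by
  induction m with
  | zero => simp
  | succ m ih =>
    rw [pow_succ, euler_mul, ih, (h.pow_left (m + 1)).eq, smul_mul_assoc, mul_assoc, ← pow_succ,
      succ_nsmul _ (m + 1)]

theorem coeff_zero_mul' (f g : PowerSeries A) : PowerSeries.coeff 0 (f * g) =
    PowerSeries.coeff 0 f * PowerSeries.coeff 0 g := by
  rw [PowerSeries.coeff_mul]
  simp

theorem commute_of_coeff {f g : PowerSeries A}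
    (h : ∀ i j, Commute (PowerSeries.coeff i f) (PowerSeries.coeff j g)) : Commute f g := by
  ext n
  rw [PowerSeries.coeff_mul, PowerSeries.coeff_mul, ← Finset.Nat.sum_antidiagonal_swap]
  exact Finset.sum_congr rfl fun ij _ => h _ _

theorem coeff_pow_eq_zero {f : PowerSeries A} (hf : PowerSeries.coeff 0 f = 0) (m : ℕ) :
    ∀ k < m, PowerSeries.coeff k (f ^ m) = 0 := by
  induction m with
  | zero => intro k hk; omega
  | succ m ih =>
    intro k hk
    rw [pow_succ, PowerSeries.coeff_mul]
    refine Finset.sum_eq_zero fun ij hij => ?_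
    have := Finset.HasAntidiagonal.mem_antidiagonal.mp hij
    by_cases h : ij.2 = 0
    · rw [h, hf, mul_zero]
    · rw [ih _ (by omega), zero_mul]

/-- A solution of `X G' = t G`, where `t` has no constant term, is determined by its constant
term. -/
theorem euler_ext {t G H : PowerSeries A} (ht : PowerSeries.coeff 0 t = 0)
    (hG : euler G = t * G) (hH : euler H = t * H)
    (h0 : PowerSeries.coeff 0 G = PowerSeries.coeff 0 H) : G = H := by
  ext n
  induction n using Nat.strong_induction_on with
  | _ n ih =>
    rcases Nat.eq_zero_or_pos n with rfl | hn
    · exact h0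
    · have hn' : (n : ℂ) ≠ 0 := by exact_mod_cast hn.ne'
      apply smul_right_injective A hn'
      simp only
      rw [← coeff_euler, ← coeff_euler, hG, hH, PowerSeries.coeff_mul, PowerSeries.coeff_mul]
      refine Finset.sum_congr rfl fun ij hij => ?_
      have := Finset.HasAntidiagonal.mem_antidiagonal.mp hij
      by_cases h : ij.1 = 0
      · rw [h, ht, zero_mul, zero_mul]
      · rw [ih _ (by omega)]

/-- The series `∑_{n ≥ 1} x n X ^ n`. -/
def expArg (x : ℕ → A) : PowerSeries A := PowerSeries.mk fun n => if n = 0 then 0 else x n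

theorem coeff_zero_expArg (x : ℕ → A) : PowerSeries.coeff 0 (expArg x) = 0 := by
  rw [expArg, PowerSeries.coeff_mk, if_pos rfl]

theorem coeff_euler_expArg (x : ℕ → A) (n : ℕ) :
    PowerSeries.coeff n (euler (expArg x)) = (n : ℂ) • x n := by
  rw [coeff_euler, expArg, PowerSeries.coeff_mk]
  split_ifs with h <;> simp [h]

theorem coeff_zero_euler (f : PowerSeries A) : PowerSeries.coeff 0 (euler f) = 0 := by
  rw [coeff_euler, Nat.cast_zero, zero_smul]

/-- The m-th power of a series without constant term starts in degree m, so any cut-off beyond k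
gives the same coefficient. This allows one common range of m for all coefficients in a convolution.
-/
theorem coeff_expSeries (x : ℕ → A) {k K : ℕ} (hK : k < K) :
    PowerSeries.coeff k (expSeries x) =
      ∑ m ∈ Finset.range K, ((m.factorial : ℂ)⁻¹) • PowerSeries.coeff k (expArg x ^ m) := by
  rw [expSeries, PowerSeries.coeff_mk]
  refine Finset.sum_subset (Finset.range_mono hK) fun m _ hm => ?_
  rw [Finset.mem_range, not_lt] at hm
  have := coeff_pow_eq_zero (coeff_zero_expArg x) m k (by omega)
  rw [expArg] at this
  rw [this, smul_zero]

theorem coeff_zero_expSeries (x : ℕ → A) : PowerSeries.coeff 0 (expSeries x) = 1 := by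
  rw [coeff_expSeries x zero_lt_one]
  simp

theorem commute_expArg {x : ℕ → A} (hx : ∀ i j, Commute (x i) (x j)) :
    Commute (expArg x) (euler (expArg x)) := by
  refine commute_of_coeff fun i j => ?_
  rw [coeff_euler_expArg, expArg, PowerSeries.coeff_mk]
  split_ifs
  · exact Commute.zero_left _
  · exact (hx i j).smul_right _

/-- Termwise differentiation of the exponential. Commutativity of the x n is what makes the
derivative of a power a multiple of t times the previous power. -/
theorem euler_expSeries {x : ℕ → A} (hx : ∀ i j, Commute (x i) (x j)) :
    euler (expSeries x) = euler (expArg x) * expSeries x := by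
  have hc := commute_expArg hx
  ext k
  have hR : PowerSeries.coeff k (euler (expArg x) * expSeries x) =
      ∑ m ∈ Finset.range (k + 1),
        ((m.factorial : ℂ)⁻¹) • PowerSeries.coeff k (euler (expArg x) * expArg x ^ m) := by
    simp only [PowerSeries.coeff_mul, Finset.smul_sum]
    rw [Finset.sum_comm]
    refine Finset.sum_congr rfl fun ij hij => ?_
    have := Finset.HasAntidiagonal.mem_antidiagonal.mp hij
    rw [coeff_expSeries x (show ij.2 < k + 1 by omega), Finset.mul_sum]
    exact Finset.sum_congr rfl fun m _ => mul_smul_comm _ _ _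
  -- The top term m = k vanishes because the logarithmic derivative has no constant term either. The
  -- remaining terms then match the differentiated terms m + 1 one to one.
  have hlast : PowerSeries.coeff k (euler (expArg x) * expArg x ^ k) = 0 := by
    rw [PowerSeries.coeff_mul]
    refine Finset.sum_eq_zero fun ij hij => ?_
    have := Finset.HasAntidiagonal.mem_antidiagonal.mp hij
    by_cases h : ij.1 = 0
    · rw [h, coeff_zero_euler, zero_mul]
    · rw [coeff_pow_eq_zero (coeff_zero_expArg x) _ _ (by omega), mul_zero]
  rw [hR, Finset.sum_range_succ, hlast, smul_zero, add_zero, coeff_euler,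
    coeff_expSeries x (Nat.lt_succ_self k), Finset.sum_range_succ',
    smul_add, Finset.smul_sum]
  have h0 : (k : ℂ) • ((Nat.factorial 0 : ℂ)⁻¹ • PowerSeries.coeff k (expArg x ^ 0)) = 0 := by
    rw [pow_zero, PowerSeries.coeff_one]
    split_ifs with h <;> simp [h]
  rw [h0, add_zero]
  refine Finset.sum_congr rfl fun m _ => ?_
  rw [smul_comm, ← coeff_euler, euler_pow hc, map_nsmul, ← Nat.cast_smul_eq_nsmul ℂ, smul_smul,
    Nat.factorial_succ]
  congr 1
  have h1 : ((m : ℂ) + 1) ≠ 0 := by exact_mod_cast Nat.succ_ne_zero m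
  have h2 : (m.factorial : ℂ) ≠ 0 := by exact_mod_cast Nat.factorial_ne_zero m
  push_cast
  field_simp

theorem commute_coeff_expSeries {x : ℕ → A} {y : A} (h : ∀ i, Commute y (x i)) (k : ℕ) :
    Commute y (PowerSeries.coeff k (expSeries x)) := by
  have key : ∀ m k, Commute y (PowerSeries.coeff k (expArg x ^ m)) := by
    intro m
    induction m with
    | zero =>
      intro k
      rw [pow_zero, PowerSeries.coeff_one]
      split_ifs
      · exact Commute.one_right _
      · exact Commute.zero_right _
    | succ m ih =>
      intro k
      rw [pow_succ, PowerSeries.coeff_mul]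
      refine Commute.sum_right _ _ _ fun ij _ => (ih _).mul_right ?_
      rw [expArg, PowerSeries.coeff_mk]
      split_ifs
      · exact Commute.zero_right _
      · exact h _
  rw [coeff_expSeries x (Nat.lt_succ_self k)]
  exact Commute.sum_right _ _ _ fun m _ => (key m k).smul_right _

theorem commute_coeff_expSeries_coeff_expSeries {x y : ℕ → A} (h : ∀ i j, Commute (x i) (y j))
    (k l : ℕ) :
    Commute (PowerSeries.coeff k (expSeries x)) (PowerSeries.coeff l (expSeries y)) :=
  (commute_coeff_expSeries (fun i => (commute_coeff_expSeries (fun j => h j i |>.symm) k)|>.symm) l)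

theorem expArg_add (x y : ℕ → A) : expArg (x + y) = expArg x + expArg y := by
  ext n
  simp only [expArg, PowerSeries.coeff_mk, map_add, Pi.add_apply]
  split_ifs <;> simp

theorem euler_add (f g : PowerSeries A) : euler (f + g) = euler f + euler g := by
  ext n
  simp only [coeff_euler, map_add, smul_add]

theorem expSeries_add {x y : ℕ → A} (hx : ∀ i j, Commute (x i) (x j))
    (hy : ∀ i j, Commute (y i) (y j)) (hxy : ∀ i j, Commute (x i) (y j)) :
    expSeries (x + y) = expSeries x * expSeries y := by
  have hs : ∀ i j, Commute ((x + y) i) ((x + y) j) := fun i j =>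
    ((hx i j).add_left (hxy j i).symm).add_right ((hxy i j).add_left (hy i j))
  refine euler_ext (coeff_zero_euler _) (euler_expSeries hs) ?_ ?_
  · have hc : Commute (expSeries x) (euler (expArg y)) := by
      refine commute_of_coeff fun i j => ?_
      rw [coeff_euler_expArg]
      exact ((commute_coeff_expSeries (fun k => (hxy k j).symm) i).symm).smul_right _
    rw [euler_mul, euler_expSeries hx, euler_expSeries hy, ← mul_assoc (expSeries x), hc.eq,
      expArg_add, euler_add, add_mul, mul_assoc, mul_assoc]
  · rw [coeff_zero_mul', coeff_zero_expSeries, coeff_zero_expSeries,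
      coeff_zero_expSeries, one_mul]

theorem expSeries_zero : expSeries (0 : ℕ → A) = 1 := by
  refine euler_ext (coeff_zero_euler _) (euler_expSeries fun _ _ => Commute.zero_left _) ?_ ?_
  · have : expArg (0 : ℕ → A) = 0 := by ext n; simp [expArg]
    rw [euler_one, this]
    ext n
    simp [coeff_euler]
  · rw [coeff_zero_expSeries]; simp

/-- This is the substitution X ↦ c X, used to evaluate one vertex operator at a multiple of the
argument of the other. -/
theorem coeff_expSeries_pow_smul {x : ℕ → A} (hx : ∀ i j, Commute (x i) (x j)) (c : ℂ) (k : ℕ) :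
    PowerSeries.coeff k (expSeries fun n => c ^ n • x n) =
      c ^ k • PowerSeries.coeff k (expSeries x) := by
  have hx' : ∀ i j, Commute (c ^ i • x i) (c ^ j • x j) := fun i j =>
    ((hx i j).smul_right _).smul_left _
  have key : expSeries (fun n => c ^ n • x n) =
      PowerSeries.mk fun k => c ^ k • PowerSeries.coeff k (expSeries x) := by
    refine euler_ext (coeff_zero_euler _) (euler_expSeries hx') ?_ ?_
    · ext n
      rw [coeff_euler, PowerSeries.coeff_mk, smul_comm, ← coeff_euler, euler_expSeries hx,
        PowerSeries.coeff_mul, PowerSeries.coeff_mul, Finset.smul_sum]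
      refine Finset.sum_congr rfl fun ij hij => ?_
      rw [← Finset.HasAntidiagonal.mem_antidiagonal.mp hij, coeff_euler_expArg,
        coeff_euler_expArg, PowerSeries.coeff_mk, pow_add, mul_smul, smul_mul_assoc,
        smul_mul_assoc, smul_mul_assoc, mul_smul_comm]
      rw [smul_comm (ij.1 : ℂ) (c ^ ij.1), smul_comm (ij.1 : ℂ) (c ^ ij.2)]
    · rw [coeff_zero_expSeries, PowerSeries.coeff_mk, coeff_zero_expSeries, pow_zero, one_smul]
  rw [key, PowerSeries.coeff_mk]

/-- The coefficients of a formal power series, extended by zero to negative indices. -/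
def zcoeff (f : PowerSeries A) (k : ℤ) : A := if 0 ≤ k then PowerSeries.coeff k.toNat f else 0

theorem zcoeff_natCast (f : PowerSeries A) (k : ℕ) : zcoeff f k = PowerSeries.coeff k f := by
  simp [zcoeff]

theorem zcoeff_of_neg (f : PowerSeries A) {k : ℤ} (hk : k < 0) : zcoeff f k = 0 := by
  rw [zcoeff, if_neg (not_le.mpr hk)]

theorem zcoeff_one (k : ℤ) : zcoeff (1 : PowerSeries A) k = if k = 0 then 1 else 0 := by
  rcases lt_or_ge k 0 with h | h
  · rw [zcoeff_of_neg _ h, if_neg h.ne]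
  · lift k to ℕ using h
    rw [zcoeff_natCast, PowerSeries.coeff_one]
    simp

/-- The Cauchy product, indexed by shifts of two integers with fixed sum. J may be any finite set
containing the support, so that one J can serve several pairs (a, b) at once. -/
theorem sum_zcoeff_mul_zcoeff (f g : PowerSeries A) (a b : ℤ) (J : Finset ℤ)
    (hJ : ∀ j, 0 ≤ a + j → 0 ≤ b - j → j ∈ J) :
    ∑ j ∈ J, zcoeff f (a + j) * zcoeff g (b - j) = zcoeff (f * g) (a + b) := by
  rcases lt_or_ge (a + b) 0 with h | h
  · rw [zcoeff_of_neg _ h]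
    refine Finset.sum_eq_zero fun j _ => ?_
    rcases lt_or_ge (a + j) 0 with h1 | h1
    · rw [zcoeff_of_neg _ h1, zero_mul]
    · rw [zcoeff_of_neg g (by omega), mul_zero]
  · obtain ⟨s, hs⟩ := Int.eq_ofNat_of_zero_le h
    rw [hs, zcoeff_natCast, PowerSeries.coeff_mul]
    symm
    refine Finset.sum_of_injOn (fun ij => (ij.1 : ℤ) - a) ?_ ?_ ?_ ?_
    · intro u hu v hv huv
      have h1 := Finset.HasAntidiagonal.mem_antidiagonal.mp hu
      have h2 := Finset.HasAntidiagonal.mem_antidiagonal.mp hv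
      simp only at huv
      exact Prod.ext (by omega) (by omega)
    · intro u hu
      have h1 := Finset.HasAntidiagonal.mem_antidiagonal.mp hu
      exact hJ _ (by simp only; omega) (by simp only; omega)
    · intro j _ hnj
      rcases lt_or_ge (a + j) 0 with h1 | h1
      · rw [zcoeff_of_neg _ h1, zero_mul]
      · rcases lt_or_ge (b - j) 0 with h2 | h2
        · rw [zcoeff_of_neg _ h2, mul_zero]
        · refine absurd ⟨((a + j).toNat, (b - j).toNat), ?_, ?_⟩ hnj
          · exact Finset.HasAntidiagonal.mem_antidiagonal.mpr (by simp only; omega)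
          · simp only; omega
    · intro u hu
      have h1 := Finset.HasAntidiagonal.mem_antidiagonal.mp hu
      have e1 : a + ((u.1 : ℤ) - a) = u.1 := by ring
      have e2 : b - ((u.1 : ℤ) - a) = u.2 := by omega
      simp only [e1, e2, zcoeff_natCast]

/-- If `[x, y n] = δ_{n,r} c` for `n ≥ 1` then `[x, exp (∑ y n X ^ n)] = c X ^ r exp (∑ y n X ^ n)`. -/
theorem commutator_expSeries {y : ℕ → A} (hy : ∀ i j, Commute (y i) (y j)) {x : A} {r : ℕ}
    (hr : r ≠ 0) {c : ℂ} (hc : ∀ n, n ≠ 0 → x * y n - y n * x = if n = r then algebraMap ℂ A c else 0)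
    (l : ℤ) : x * zcoeff (expSeries y) l =
      zcoeff (expSeries y) l * x + c • zcoeff (expSeries y) (l - r) := by
  set E := expSeries y with hE
  have hcoeff : ∀ n : ℕ, x * PowerSeries.coeff n E =
      PowerSeries.coeff n E * x + c • zcoeff E (n - r) := by
    intro n
    induction n using Nat.strong_induction_on with
    | _ n ih =>
      rcases Nat.eq_zero_or_pos n with rfl | hn
      · rw [hE, coeff_zero_expSeries, zcoeff_of_neg _ (by omega)]
        simp
      · have hn' : (n : ℂ) ≠ 0 := by exact_mod_cast hn.ne'
        apply smul_right_injective A hn'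
        -- Euler's recursion n E_n = ∑ i y_i E_{n-i} expresses E_n through lower coefficients and
        -- drives the strong induction.
        have hEn : (n : ℂ) • PowerSeries.coeff n E = ∑ ij ∈ Finset.HasAntidiagonal.antidiagonal n,
            ((ij.1 : ℂ) • y ij.1) * PowerSeries.coeff ij.2 E := by
          rw [← coeff_euler, hE, euler_expSeries hy, PowerSeries.coeff_mul]
          exact Finset.sum_congr rfl fun ij _ => by rw [coeff_euler_expArg]
        simp only
        rw [← mul_smul_comm, smul_add, ← smul_mul_assoc, hEn, Finset.mul_sum, Finset.sum_mul,
          smul_comm]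
        have hterm : ∀ ij ∈ Finset.HasAntidiagonal.antidiagonal n,
            x * (((ij.1 : ℂ) • y ij.1) * PowerSeries.coeff ij.2 E) =
            ((ij.1 : ℂ) • y ij.1) * PowerSeries.coeff ij.2 E * x +
            ((if ij.1 = r then (r * c) • PowerSeries.coeff ij.2 E else 0) +
              c • (((ij.1 : ℂ) • y ij.1) * zcoeff E (ij.2 - r))) := by
          intro ij hij
          have hm := Finset.HasAntidiagonal.mem_antidiagonal.mp hij
          by_cases h0 : ij.1 = 0
          · have : ij.1 ≠ r := by omega
            simp [h0, Ne.symm hr]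
          · have h1 := hc ij.1 h0
            have h2 := ih ij.2 (by omega)
            have h3 : x * y ij.1 = y ij.1 * x + (if ij.1 = r then algebraMap ℂ A c else 0) := by
              rw [← h1]; abel
            rw [smul_mul_assoc, mul_smul_comm, ← mul_assoc, h3, add_mul, mul_assoc, h2, mul_add]
            split_ifs with hir
            · rw [hir, ← Algebra.smul_def]
              simp only [smul_add, smul_smul, smul_mul_assoc, mul_smul_comm, mul_assoc]
              rw [mul_comm c]
              abel
            · simp only [smul_add, smul_smul, smul_mul_assoc, mul_smul_comm, mul_assoc, zero_mul,
                smul_zero, zero_add]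
              rw [mul_comm c]
              abel
        rw [Finset.sum_congr rfl hterm, Finset.sum_add_distrib, Finset.sum_add_distrib,
          ← Finset.smul_sum]
        congr 1
        -- The commutator with y_r itself contributes r c E_{n-r}. The inductive terms contribute (n
        -- - r) c E_{n-r}, by the recursion in degree n - r. Together they give n c E_{n-r}.
        have hA : ∑ ij ∈ Finset.HasAntidiagonal.antidiagonal n,
            (if ij.1 = r then (r * c) • PowerSeries.coeff ij.2 E else 0) =
            ((r : ℂ) * c) • zcoeff E (n - r) := by
          by_cases hrn : r ≤ n
          · rw [Finset.sum_eq_single (r, n - r)]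
            · rw [if_pos rfl, ← zcoeff_natCast]
              congr 2
              push_cast [hrn]; rfl
            · intro ij hij hne
              rw [if_neg]
              intro h
              have := Finset.HasAntidiagonal.mem_antidiagonal.mp hij
              exact hne (Prod.ext h (by simp only; omega))
            · intro h
              exact absurd (Finset.HasAntidiagonal.mem_antidiagonal.mpr (by simp only; omega)) h
          · rw [zcoeff_of_neg _ (by omega), smul_zero]
            refine Finset.sum_eq_zero fun ij hij => if_neg ?_
            have := Finset.HasAntidiagonal.mem_antidiagonal.mp hij
            omega
        have hB : ∑ ij ∈ Finset.HasAntidiagonal.antidiagonal n, ((ij.1 : ℂ) • y ij.1) * zcoeff E (ij.2 - r) =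
            ((n : ℂ) - r) • zcoeff E (n - r) := by
          by_cases hrn : r ≤ n
          · obtain ⟨s, rfl⟩ := Nat.exists_eq_add_of_le hrn
            have hs : (((r + s : ℕ) : ℤ) - r) = (s : ℤ) := by push_cast; ring
            have hs' : (((r + s : ℕ) : ℂ) - r) = (s : ℂ) := by push_cast; ring
            rw [hs, hs', zcoeff_natCast, ← coeff_euler, hE, euler_expSeries hy,
              PowerSeries.coeff_mul, ← hE]
            symm
            refine Finset.sum_of_injOn (fun ij => (ij.1, ij.2 + r)) ?_ ?_ ?_ ?_
            · intro u _ v _ h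
              simp only [Prod.mk.injEq] at h
              exact Prod.ext h.1 (by omega)
            · intro u hu
              have := Finset.HasAntidiagonal.mem_antidiagonal.mp hu
              exact Finset.HasAntidiagonal.mem_antidiagonal.mpr (by simp only; omega)
            · intro u hu hnu
              have := Finset.HasAntidiagonal.mem_antidiagonal.mp hu
              rw [zcoeff_of_neg, mul_zero]
              by_contra hneg
              refine hnu ⟨(u.1, u.2 - r), ?_, ?_⟩
              · exact Finset.HasAntidiagonal.mem_antidiagonal.mpr (by simp only; omega)
              · exact Prod.ext rfl (by simp only; omega)
            · intro u _
              rw [coeff_euler_expArg, ← zcoeff_natCast]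
              congr 2
              push_cast; ring
          · rw [zcoeff_of_neg _ (by omega), smul_zero]
            refine Finset.sum_eq_zero fun ij hij => ?_
            have := Finset.HasAntidiagonal.mem_antidiagonal.mp hij
            rw [zcoeff_of_neg _ (by omega), mul_zero]
        rw [hA, hB, smul_smul, smul_smul, ← add_smul]
        congr 1
        ring
  rcases lt_or_ge l 0 with hl | hl
  · rw [zcoeff_of_neg _ hl, zcoeff_of_neg _ (by omega)]
    simp
  · lift l to ℕ using hl
    rw [zcoeff_natCast]
    exact hcoeff l

/-- The exchange relation `exp (∑ x n z ^ (-n)) exp (∑ y n w ^ n) =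
exp (∑ c n (w / z) ^ n) exp (∑ y n w ^ n) exp (∑ x n z ^ (-n))` when `[x n, y m] = δ_{n,m} c n`. -/
theorem coeff_expSeries_mul_zcoeff {x y : ℕ → A} {c : ℕ → ℂ} (hx : ∀ i j, Commute (x i) (x j))
    (hy : ∀ i j, Commute (y i) (y j))
    (hc : ∀ m n, m ≠ 0 → n ≠ 0 →
      x m * y n - y n * x m = if n = m then algebraMap ℂ A (c m) else 0) (k : ℕ) (l : ℤ) :
    PowerSeries.coeff k (expSeries x) * zcoeff (expSeries y) l =
      ∑ ij ∈ Finset.HasAntidiagonal.antidiagonal k, PowerSeries.coeff ij.1 (expSeries c) •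
        (zcoeff (expSeries y) (l - ij.1) * PowerSeries.coeff ij.2 (expSeries x)) := by
  -- R is the expected conjugate of the coefficient E_l of exp(∑ y) by exp(∑ x). The commutator of
  -- the logarithmic derivative of exp(∑ x) with R is the Euler derivative of R, so both sides of
  -- the exchange relation solve the same differential equation.
  set R : PowerSeries A := PowerSeries.mk fun i =>
    PowerSeries.coeff i (expSeries c) • zcoeff (expSeries y) (l - i) with hR
  have hcc : ∀ i j, Commute (c i) (c j) := fun i j => Commute.all _ _
  have hcomm : euler (expArg x) * R = R * euler (expArg x) + euler R := by
    ext r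
    have e1 : PowerSeries.coeff r (R * euler (expArg x)) = ∑ ij ∈ Finset.HasAntidiagonal.antidiagonal r,
        PowerSeries.coeff ij.2 R * PowerSeries.coeff ij.1 (euler (expArg x)) := by
      rw [PowerSeries.coeff_mul, ← Finset.Nat.sum_antidiagonal_swap]
      rfl
    have e2 : PowerSeries.coeff r (euler R) = ∑ ij ∈ Finset.HasAntidiagonal.antidiagonal r,
        ((ij.1 : ℂ) * c ij.1 * PowerSeries.coeff ij.2 (expSeries c)) •
          zcoeff (expSeries y) (l - r) := by
      rw [← Finset.sum_smul, coeff_euler, hR, PowerSeries.coeff_mk, smul_smul]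
      congr 1
      have := congrArg (PowerSeries.coeff r) (euler_expSeries hcc)
      rw [coeff_euler, PowerSeries.coeff_mul, smul_eq_mul] at this
      rw [this]
      exact Finset.sum_congr rfl fun ij _ => by rw [coeff_euler_expArg, smul_eq_mul]
    rw [map_add, e1, e2, PowerSeries.coeff_mul, ← Finset.sum_add_distrib]
    refine Finset.sum_congr rfl fun ij hij => ?_
    have hm := Finset.HasAntidiagonal.mem_antidiagonal.mp hij
    rw [coeff_euler_expArg, hR, PowerSeries.coeff_mk]
    by_cases h0 : ij.1 = 0
    · simp [h0]
    · have h1 := commutator_expSeries hy h0 (fun n hn => hc ij.1 n h0 hn) (l - ij.2)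
      have h2 : l - (r : ℤ) = l - ij.2 - ij.1 := by rw [← hm]; push_cast; ring
      rw [h2, smul_mul_assoc, mul_smul_comm, h1]
      simp only [smul_add, smul_smul, smul_mul_assoc, mul_smul_comm]
      congr 2; ring
  have key : expSeries x * PowerSeries.C (zcoeff (expSeries y) l) = R * expSeries x := by
    refine euler_ext (coeff_zero_euler (expArg x)) ?_ ?_ ?_
    · rw [euler_mul, euler_C, mul_zero, add_zero, euler_expSeries hx, mul_assoc]
    · rw [euler_mul, euler_expSeries hx, ← mul_assoc, ← mul_assoc, hcomm, add_mul, add_comm]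
    · rw [coeff_zero_mul', coeff_zero_mul', coeff_zero_expSeries,
        hR, PowerSeries.coeff_mk, coeff_zero_expSeries, PowerSeries.coeff_zero_C]
      simp
  have := congrArg (PowerSeries.coeff k) key
  rw [PowerSeries.coeff_mul_C, PowerSeries.coeff_mul] at this
  rw [this]
  refine Finset.sum_congr rfl fun ij _ => ?_
  rw [hR, PowerSeries.coeff_mk, smul_mul_assoc]

end Euler

/-! ## Commutation relations of the bosons -/

section Bosons

variable (p : Params)

theorem alpha_succ (a i : Fin 2) (k : ℕ) : alpha p a i ((k + 1 : ℕ) : ℤ) =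
    ∑ j : Fin 2, p.heis i j (k + 1) • (MvPolynomial.pderiv (a, j, k)).toLinearMap := rfl

theorem alpha_neg_succ (a i : Fin 2) (k : ℕ) : alpha p a i (-((k + 1 : ℕ) : ℤ)) =
    LinearMap.mulLeft ℂ (MvPolynomial.X (a, i, k)) := rfl

/-- The commutator of two derivations is a derivation, and this one kills every variable. -/
theorem commute_pderiv {σ : Type} (s t : σ) :
    Commute (MvPolynomial.pderiv (R := ℂ) s).toLinearMap
      (MvPolynomial.pderiv (R := ℂ) t).toLinearMap := by
  classical
  have h : ⁅MvPolynomial.pderiv (R := ℂ) s, MvPolynomial.pderiv (R := ℂ) t⁆ = 0 := by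
    apply MvPolynomial.derivation_ext
    intro i
    simp only [Derivation.commutator_apply, MvPolynomial.pderiv_X, Pi.single_apply,
      Derivation.coe_zero, Pi.zero_apply]
    split_ifs <;> simp
  refine LinearMap.ext fun v => ?_
  have := congrArg (fun D => D v) h
  simp only [Derivation.commutator_apply, Derivation.coe_zero, Pi.zero_apply] at this
  exact sub_eq_zero.mp this

theorem commute_alpha_pos (a a' i j : Fin 2) (k l : ℕ) :
    Commute (alpha p a i (k : ℤ)) (alpha p a' j (l : ℤ)) := by
  cases k with
  | zero => exact Commute.zero_left _
  | succ k =>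
    cases l with
    | zero => exact Commute.zero_right _
    | succ l =>
      rw [alpha_succ, alpha_succ]
      exact Commute.sum_left _ _ _ fun _ _ => Commute.sum_right _ _ _ fun _ _ =>
        ((commute_pderiv _ _).smul_right _).smul_left _

theorem commute_alpha_neg (a a' i j : Fin 2) (k l : ℕ) :
    Commute (alpha p a i (-(k : ℤ))) (alpha p a' j (-(l : ℤ))) := by
  cases k with
  | zero => exact Commute.zero_left _
  | succ k =>
    cases l with
    | zero => exact Commute.zero_right _
    | succ l =>
      rw [alpha_neg_succ, alpha_neg_succ]
      refine LinearMap.ext fun v => ?_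
      simp only [Module.End.mul_apply, LinearMap.mulLeft_apply]
      ring

theorem alpha_commutator (a a' i j : Fin 2) {m n : ℕ} (hm : m ≠ 0) (hn : n ≠ 0) :
    alpha p a i (m : ℤ) * alpha p a' j (-(n : ℤ)) - alpha p a' j (-(n : ℤ)) * alpha p a i (m : ℤ) =
      if a = a' ∧ n = m then p.heis i j m • 1 else 0 := by
  obtain ⟨m, rfl⟩ := Nat.exists_eq_succ_of_ne_zero hm
  obtain ⟨n, rfl⟩ := Nat.exists_eq_succ_of_ne_zero hn
  rw [Nat.succ_eq_add_one, Nat.succ_eq_add_one, alpha_succ, alpha_neg_succ]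
  refine LinearMap.ext fun v => ?_
  have h : ∀ j', MvPolynomial.pderiv (R := ℂ) (a, j', m)
      (MvPolynomial.X (a', j, n) * v) = (if a = a' ∧ j' = j ∧ n = m then v else 0) +
        MvPolynomial.X (a', j, n) * MvPolynomial.pderiv (R := ℂ) (a, j', m) v := by
    intro j'
    rw [Derivation.leibniz, MvPolynomial.pderiv_X, smul_eq_mul, smul_eq_mul, add_comm]
    congr 1
    rw [Pi.single_apply]
    by_cases h : a = a' ∧ j' = j ∧ n = m
    · obtain ⟨rfl, rfl, rfl⟩ := h
      simp
    · rw [if_neg h, if_neg, mul_zero]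
      rintro h'
      simp only [Prod.mk.injEq] at h'
      exact h ⟨h'.1.symm, h'.2.1.symm, h'.2.2⟩
  simp only [LinearMap.sub_apply, Module.End.mul_apply, LinearMap.mulLeft_apply,
    LinearMap.sum_apply, LinearMap.smul_apply, Derivation.coeFn_coe,
    h, Finset.mul_sum, smul_add, Finset.sum_add_distrib, mul_smul_comm, add_sub_cancel_right]
  by_cases hc : a = a' ∧ n = m
  · obtain ⟨rfl, rfl⟩ := hc
    simp
  · rw [if_neg (by rintro ⟨h1, h2⟩; exact hc ⟨h1, by omega⟩)]
    refine Finset.sum_eq_zero fun j' _ => ?_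
    rw [if_neg (by rintro ⟨h1, _, h2⟩; exact hc ⟨h1, h2⟩), smul_zero]

variable {p}

/-! ### Consequences of the genericity of q and d. -/

namespace Params.Admissible

theorem q₁_ne_zero (hp : p.Admissible) : p.q₁ ≠ 0 :=
  mul_ne_zero (inv_ne_zero hp.q_ne_zero) hp.d_ne_zero

theorem q₃_ne_zero (hp : p.Admissible) : p.q₃ ≠ 0 :=
  mul_ne_zero (inv_ne_zero hp.q_ne_zero) (inv_ne_zero hp.d_ne_zero)

theorem q_sq_mul (hp : p.Admissible) : p.q ^ 2 * (p.q₁ * p.q₃) = 1 := by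
  have := hp.q_ne_zero
  have := hp.d_ne_zero
  unfold Params.q₁ Params.q₃
  field_simp

theorem q_pow_ne_one (hp : p.Admissible) {n : ℕ} (hn : n ≠ 0) : p.q ^ n ≠ 1 := by
  have := hp.generic n 0 (Or.inl (by exact_mod_cast hn))
  simpa using this

theorem one_add_q_pow_ne_zero (hp : p.Admissible) {n : ℕ} (hn : n ≠ 0) :
    1 + (p.q ^ n) ^ 2 ≠ 0 := by
  intro h
  have h1 : (p.q ^ n) ^ 2 = -1 := by linear_combination h
  refine hp.q_pow_ne_one (n := n * 4) (by omega) ?_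
  rw [pow_mul, show 4 = 2 * 2 from rfl, pow_mul, h1]
  norm_num

theorem one_sub_q_pow_ne_zero (hp : p.Admissible) {n : ℕ} (hn : n ≠ 0) :
    1 - (p.q ^ n) ^ 2 ≠ 0 := by
  intro h
  refine hp.q_pow_ne_one (n := n * 2) (by omega) ?_
  rw [pow_mul]
  linear_combination -h

theorem cartanScalar_ne_zero (hp : p.Admissible) {n : ℤ} (hn : n ≠ 0) : cartanScalar p n ≠ 0 := by
  have hq := hp.q_ne_zero
  have h1 : 1 - p.q₂ ^ n ≠ 0 := by
    intro h
    refine hp.generic (2 * n) 0 (Or.inl (by omega)) ?_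
    rw [zpow_mul, zpow_zero, mul_one]
    unfold Params.q₂ at h
    rw [show p.q ^ (2 : ℤ) = p.q ^ 2 from by norm_cast]
    linear_combination -h
  have h2 : p.q - p.q⁻¹ ≠ 0 := by
    intro h
    refine hp.one_sub_q_pow_ne_zero one_ne_zero ?_
    field_simp at h
    linear_combination -h
  have h3 : (n : ℂ) ≠ 0 := by exact_mod_cast hn
  exact neg_ne_zero.mpr (div_ne_zero h1 (mul_ne_zero h3 h2))

theorem heis_self_ne_zero (hp : p.Admissible) (i : Fin 2) {n : ℤ} (hn : n ≠ 0) :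
    p.heis i i n ≠ 0 := by
  have hq := pow_ne_zero n.natAbs hp.q_ne_zero
  have h1 := hp.one_add_q_pow_ne_zero (n := n.natAbs) (by omega)
  rw [Params.heis, if_pos rfl]
  refine mul_ne_zero (by exact_mod_cast hn) ?_
  unfold Params.q₂
  rw [inv_pow, ← pow_mul, mul_comm, pow_mul]
  have h2 := inv_ne_zero (pow_ne_zero 2 hq)
  have h3 : 1 + ((p.q ^ n.natAbs) ^ 2)⁻¹ =
      (1 + (p.q ^ n.natAbs) ^ 2) * ((p.q ^ n.natAbs) ^ 2)⁻¹ := by field_simp; ring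
  rw [h3]
  exact mul_ne_zero h1 h2

end Params.Admissible

/-- Genericity makes the brackets in the definition nonzero, so the quotient is a genuine one and
the Cartan scalars drop out of it. The resulting coefficients depend only on |n| and not on the
colour. -/
theorem boson_eq (hp : p.Admissible) (i : Fin 2) {n : ℤ} (hn : n ≠ 0) :
    boson p i n = ((p.q ^ n.natAbs) ^ 2 / (1 + (p.q ^ n.natAbs) ^ 2)) • alpha p 0 i n +
      (-(p.q ^ n.natAbs / (1 + (p.q ^ n.natAbs) ^ 2))) • alpha p 1 i n := by
  have h1 := hp.cartanScalar_ne_zero hn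
  have h2 := hp.cartanScalar_ne_zero (neg_ne_zero.mpr hn)
  have h3 := hp.heis_self_ne_zero i hn
  have h4 := hp.one_add_q_pow_ne_zero (n := n.natAbs) (by omega)
  have h5 : alphaCartanBracket p i n / cartanBracket p i n * cartanScalar p n =
      1 / (1 + (p.q ^ n.natAbs) ^ 2) := by
    unfold alphaCartanBracket cartanBracket
    rw [← sq]
    field_simp
  rw [boson, cartan, smul_smul, h5, smul_add, smul_smul]
  have h6 : (p.q ^ n.natAbs) ^ 2 / (1 + (p.q ^ n.natAbs) ^ 2) =
      1 - 1 / (1 + (p.q ^ n.natAbs) ^ 2) := by field_simp; ring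
  have h7 : p.q ^ n.natAbs / (1 + (p.q ^ n.natAbs) ^ 2) =
      1 / (1 + (p.q ^ n.natAbs) ^ 2) * p.q ^ n.natAbs := by ring
  rw [h6, h7]
  refine LinearMap.ext fun v => ?_
  simp only [LinearMap.sub_apply, LinearMap.add_apply, LinearMap.smul_apply]
  module

theorem commute_boson_pos (i j : Fin 2) (k l : ℕ) :
    Commute (boson p i (k : ℤ)) (boson p j (l : ℤ)) := by
  have h : ∀ a, Commute (alpha p a i (k : ℤ)) (boson p j (l : ℤ)) := fun a =>
    (commute_alpha_pos p _ _ _ _ _ _).sub_right (((commute_alpha_pos p _ _ _ _ _ _).add_right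
      ((commute_alpha_pos p _ _ _ _ _ _).smul_right _)).smul_right _ |>.smul_right _)
  exact (h 0).sub_left ((((h 0).add_left ((h 1).smul_left _)).smul_left _).smul_left _)

theorem commute_boson_neg (i j : Fin 2) (k l : ℕ) :
    Commute (boson p i (-(k : ℤ))) (boson p j (-(l : ℤ))) := by
  have h : ∀ a, Commute (alpha p a i (-(k : ℤ))) (boson p j (-(l : ℤ))) := fun a =>
    (commute_alpha_neg p _ _ _ _ _ _).sub_right (((commute_alpha_neg p _ _ _ _ _ _).add_right
      ((commute_alpha_neg p _ _ _ _ _ _).smul_right _)).smul_right _ |>.smul_right _)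
  exact (h 0).sub_left ((((h 0).add_left ((h 1).smul_left _)).smul_left _).smul_left _)

theorem commutator_smul_add_smul {A : Type*} [Ring A] [Algebra ℂ A] (u v u' v' : ℂ)
    (x y x' y' : A) :
    (u • x + v • y) * (u' • x' + v' • y') - (u' • x' + v' • y') * (u • x + v • y) =
      (u * u') • (x * x' - x' * x) + (v * v') • (y * y' - y' * y) +
        ((u * v') • (x * y' - y' * x) + (v * u') • (y * x' - x' * y)) := by
  simp only [mul_add, add_mul, smul_mul_assoc, mul_smul_comm]
  module

/-- The scalar `[b_{i,n}, b_{j,-n}]` for `n ≥ 1`. -/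
def bosonBracket (p : Params) (i j : Fin 2) (n : ℕ) : ℂ := p.heis i j n / (1 + (p.q₂ ^ n)⁻¹)

theorem boson_commutator (hp : p.Admissible) (i j : Fin 2) {m n : ℕ} (hm : m ≠ 0) (hn : n ≠ 0) :
    boson p i (m : ℤ) * boson p j (-(n : ℤ)) - boson p j (-(n : ℤ)) * boson p i (m : ℤ) =
      if n = m then bosonBracket p i j m • 1 else 0 := by
  rw [boson_eq hp i (by exact_mod_cast hm : (m : ℤ) ≠ 0),
    boson_eq hp j (by simpa using hn : (-(n : ℤ)) ≠ 0), Int.natAbs_neg, Int.natAbs_natCast,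
    Int.natAbs_natCast]
  refine (commutator_smul_add_smul _ _ _ _ _ _ _ _).trans ?_
  rw [ alpha_commutator p 0 0 i j hm hn, alpha_commutator p 1 1 i j hm hn,
    alpha_commutator p 0 1 i j hm hn, alpha_commutator p 1 0 i j hm hn]
  by_cases h : n = m
  · subst h
    have hq := pow_ne_zero n hp.q_ne_zero
    have h1 := hp.one_add_q_pow_ne_zero hn
    have h2 : p.q₂ ^ n = (p.q ^ n) ^ 2 := by
      unfold Params.q₂; rw [← pow_mul, ← pow_mul, mul_comm]
    simp only [and_true, if_true, smul_smul, ← add_smul, zero_ne_one, one_ne_zero,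
      if_false, smul_zero, add_zero, bosonBracket, h2]
    -- With Q = qⁿ the two tensor factors contribute (Q⁴ + Q²)/(1 + Q²)² = 1/(1 + Q⁻²).
    congr 1
    have h3 : 1 + ((p.q ^ n) ^ 2)⁻¹ ≠ 0 := by
      have h3 : 1 + ((p.q ^ n) ^ 2)⁻¹ = (1 + (p.q ^ n) ^ 2) * ((p.q ^ n) ^ 2)⁻¹ := by
        field_simp
        ring
      rw [h3]
      exact mul_ne_zero h1 (inv_ne_zero (pow_ne_zero 2 hq))
    generalize p.q ^ n = Q at *
    generalize p.heis i j n = h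
    have h4 : 1 + (Q ^ 2)⁻¹ = (1 + Q ^ 2) * (Q ^ 2)⁻¹ := by field_simp; ring
    rw [h4]
    field_simp
    ring
  · simp [h]

end Bosons

/-! ## Products of normally ordered exponentials -/

/-- A sum supported in a rectangle is rearranged along antidiagonals. The bound I + J covers all
antidiagonals that meet the rectangle. -/
theorem sum_range_sum_antidiagonal {V : Type*} [AddCommMonoid V] (F : ℕ → ℕ → V) {I J M : ℕ}
    (hI : ∀ i j, I ≤ i → F i j = 0) (hJ : ∀ i j, J ≤ j → F i j = 0) (hM : I + J ≤ M) :
    ∑ m ∈ Finset.range M, ∑ ij ∈ Finset.HasAntidiagonal.antidiagonal m, F ij.1 ij.2 =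
      ∑ i ∈ Finset.range I, ∑ j ∈ Finset.range J, F i j := by
  rw [← Finset.sum_product', ← Finset.sum_fiberwise_of_maps_to
    (s := Finset.range I ×ˢ Finset.range J) (t := Finset.range M) (g := fun u => u.1 + u.2)]
  · refine Finset.sum_congr rfl fun m _ => ?_
    symm
    refine Finset.sum_subset ?_ ?_
    · intro u hu
      exact Finset.HasAntidiagonal.mem_antidiagonal.mpr (Finset.mem_filter.mp hu).2
    · intro u hu hnu
      have h1 := Finset.HasAntidiagonal.mem_antidiagonal.mp hu
      by_contra hne
      refine hnu (Finset.mem_filter.mpr ⟨Finset.mem_product.mpr ⟨?_, ?_⟩, h1⟩)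
      · exact Finset.mem_range.mpr (not_le.mp fun h => hne (hI _ _ h))
      · exact Finset.mem_range.mpr (not_le.mp fun h => hne (hJ _ _ h))
  · intro u hu
    have h1 := Finset.mem_range.mp (Finset.mem_product.mp hu).1
    have h2 := Finset.mem_range.mp (Finset.mem_product.mp hu).2
    exact Finset.mem_range.mpr (by omega)

variable {p : Params}

namespace LinField

/-- The modes of positive index. -/
def annArg (p : Params) (φ : LinField) (n : ℕ) : Module.End ℂ Osc :=
  ∑ i : Fin 2, φ.osc i (n : ℤ) • boson p i (n : ℤ)

/-- The modes of negative index. -/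
def creArg (p : Params) (φ : LinField) (n : ℕ) : Module.End ℂ Osc :=
  ∑ i : Fin 2, φ.osc i (-(n : ℤ)) • boson p i (-(n : ℤ))

theorem annihilation_eq (φ : LinField) : φ.annihilation p = expSeries (φ.annArg p) := rfl

theorem creation_eq (φ : LinField) : φ.creation p = expSeries (φ.creArg p) := rfl

theorem commute_annArg (φ ψ : LinField) (m n : ℕ) : Commute (φ.annArg p m) (ψ.annArg p n) :=
  Commute.sum_left _ _ _ fun _ _ => Commute.sum_right _ _ _ fun _ _ =>
    ((commute_boson_pos _ _ _ _).smul_right _).smul_left _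

theorem commute_creArg (φ ψ : LinField) (m n : ℕ) : Commute (φ.creArg p m) (ψ.creArg p n) :=
  Commute.sum_left _ _ _ fun _ _ => Commute.sum_right _ _ _ fun _ _ =>
    ((commute_boson_neg _ _ _ _).smul_right _).smul_left _

/-- The scalar commutator of the `n`-th annihilation mode of `φ` with the `n`-th creation mode
of `ψ`. -/
def contraction (p : Params) (φ ψ : LinField) (n : ℕ) : ℂ :=
  ∑ i : Fin 2, ∑ j : Fin 2, φ.osc i (n : ℤ) * ψ.osc j (-(n : ℤ)) * bosonBracket p i j n

theorem commutator_annArg_creArg (hp : p.Admissible) (φ ψ : LinField) {m n : ℕ} (hm : m ≠ 0)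
    (hn : n ≠ 0) :
    φ.annArg p m * ψ.creArg p n - ψ.creArg p n * φ.annArg p m =
      if n = m then algebraMap ℂ (Module.End ℂ Osc) (φ.contraction p ψ m) else 0 := by
  have h : ∀ i j : Fin 2, (φ.osc i m • boson p i m) * (ψ.osc j (-n) • boson p j (-n)) -
      (ψ.osc j (-n) • boson p j (-n)) * (φ.osc i m • boson p i m) =
      if n = m then (φ.osc i m * ψ.osc j (-m) * bosonBracket p i j m) •
        (1 : Module.End ℂ Osc) else 0 := by
    intro i j
    have := boson_commutator hp i j hm hn
    rw [smul_mul_smul_comm, smul_mul_smul_comm, mul_comm (ψ.osc j _)]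
    refine (smul_sub _ _ _).symm.trans ?_
    rw [this]
    split_ifs with hnm
    · rw [smul_smul, hnm]
    · rw [smul_zero]
  unfold annArg creArg contraction
  rw [Finset.sum_mul_sum, Finset.sum_mul_sum, Finset.sum_comm (s := Finset.univ (α := Fin 2))]
  simp only [Fin.sum_univ_two]
  have e : ∀ a b c d a' b' c' d' : Module.End ℂ Osc, a + b + (c + d) - (a' + b' + (c' + d')) =
      (a - a') + (b - b') + ((c - c') + (d - d')) := by intros; abel
  rw [e, h 0 0, h 1 0, h 0 1, h 1 1, Algebra.algebraMap_eq_smul_one]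
  split_ifs with hnm
  · simp only [add_smul]
    abel
  · simp only [add_zero]

theorem coeff_annihilation_mem (φ : LinField) {N : ℕ} {f : Osc} (hf : f ∈ oscFilt N) (m : ℕ) :
    PowerSeries.coeff m (φ.annihilation p) f ∈ oscFilt (N - m) :=
  lowers_expSeries (φ.annArg p)
    (fun k => Lowers.sum _ _ fun i _ => (lowers_boson p i k).smul _) m N f hf

theorem coeff_annihilation_eq_zero (φ : LinField) {N : ℕ} {f : Osc} (hf : f ∈ oscFilt N) {m : ℕ}
    (hm : N ≤ m) : PowerSeries.coeff m (φ.annihilation p) f = 0 := by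
  have := φ.coeff_annihilation_mem (p := p) hf m
  rwa [Nat.sub_eq_zero_of_le hm, oscFilt_zero, Submodule.mem_bot] at this

theorem oscMode_apply (φ : LinField) (k : ℤ) {f : Osc} {M : ℕ}
    (hM : ∀ m, M ≤ m → PowerSeries.coeff m (φ.annihilation p) f = 0) :
    φ.oscMode p k f = ∑ m ∈ Finset.range M,
      zcoeff (φ.creation p) (m + k) (PowerSeries.coeff m (φ.annihilation p) f) := by
  have h : ∀ m : ℕ, φ.oscTerm p k m f =
      zcoeff (φ.creation p) (m + k) (PowerSeries.coeff m (φ.annihilation p) f) := by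
    intro m
    unfold oscTerm zcoeff
    split_ifs <;> rfl
  change ∑ᶠ m : ℕ, φ.oscTerm p k m f = _
  simp only [h]
  refine finsum_eq_sum_of_support_subset _ fun m hm => ?_
  rw [Finset.coe_range, Set.mem_Iio]
  by_contra hc
  refine hm ?_
  simp only
  rw [hM m (not_lt.mp hc), map_zero]

/-- The coefficient of `z ^ k w ^ l` in the oscillator part of `:exp φ(z) exp ψ(w):`, cut off at
annihilation modes of index less than `N`. -/
def normalProd (p : Params) (φ ψ : LinField) (N : ℕ) (k l : ℤ) : Module.End ℂ Osc :=
  ∑ m ∈ Finset.range N, ∑ n ∈ Finset.range N,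
    (zcoeff (φ.creation p) (m + k) * zcoeff (ψ.creation p) (n + l)) *
      (PowerSeries.coeff m (φ.annihilation p) * PowerSeries.coeff n (ψ.annihilation p))

theorem commute_creation (φ ψ : LinField) (k l : ℤ) :
    Commute (zcoeff (φ.creation p) k) (zcoeff (ψ.creation p) l) := by
  unfold zcoeff
  split_ifs
  · exact commute_coeff_expSeries_coeff_expSeries (commute_creArg φ ψ) _ _
  all_goals first | exact Commute.zero_left _ | exact Commute.zero_right _

theorem commute_annihilation (φ ψ : LinField) (k l : ℕ) :
    Commute (PowerSeries.coeff k (φ.annihilation p)) (PowerSeries.coeff l (ψ.annihilation p)) :=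
  commute_coeff_expSeries_coeff_expSeries (commute_annArg φ ψ) _ _

theorem normalProd_comm (φ ψ : LinField) (N : ℕ) (k l : ℤ) :
    normalProd p φ ψ N k l = normalProd p ψ φ N l k := by
  unfold normalProd
  rw [Finset.sum_comm]
  refine Finset.sum_congr rfl fun m _ => Finset.sum_congr rfl fun n _ => ?_
  rw [(commute_creation φ ψ _ _).eq, (commute_annihilation φ ψ _ _).eq]

/-- Because of the cut-off n < N, the creation coefficient has negative index n + l. Without the
cut-off this vanishing would hold only after application to a vector of degree less than N. -/
theorem normalProd_eq_zero_right (φ ψ : LinField) {N : ℕ} (k : ℤ) {l : ℤ} (hl : l ≤ -N) :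
    normalProd p φ ψ N k l = 0 := by
  refine Finset.sum_eq_zero fun m _ => Finset.sum_eq_zero fun n hn => ?_
  have := Finset.mem_range.mp hn
  rw [zcoeff_of_neg (ψ.creation p) (by omega), mul_zero, zero_mul]

theorem normalProd_eq_zero_left (φ ψ : LinField) {N : ℕ} {k : ℤ} (l : ℤ) (hk : k ≤ -N) :
    normalProd p φ ψ N k l = 0 := by
  rw [normalProd_comm, normalProd_eq_zero_right ψ φ l hk]

/-- The annihilation coefficients of φ are moved past the creation coefficient of ψ by the exchange
relation; i counts the degree absorbed by the contraction. Terms with i ≥ I have a negative creation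
index, and terms with j ≥ N kill u. -/
theorem oscMode_zcoeff_creation (hp : p.Admissible) (φ ψ : LinField) (k r : ℤ) {N : ℕ} {u : Osc}
    (hu : u ∈ oscFilt N) {I : ℕ} (hI : r < I) :
    φ.oscMode p k (zcoeff (ψ.creation p) r u) = ∑ i ∈ Finset.range I, ∑ j ∈ Finset.range N,
      PowerSeries.coeff i (expSeries (φ.contraction p ψ)) •
        zcoeff (φ.creation p) (j + (k + i)) (zcoeff (ψ.creation p) (r - i)
          (PowerSeries.coeff j (φ.annihilation p) u)) := by
  -- The degree of the vector after creation is bounded by some M₀ only. The cut-off M₀ + (I + N)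
  -- exceeds this bound and also covers the I by N rectangle of the rearranged sum.
  obtain ⟨M₀, hM₀⟩ := exists_mem_oscFilt (zcoeff (ψ.creation p) r u)
  rw [φ.oscMode_apply (M := M₀ + (I + N)) k
    fun m hm => coeff_annihilation_eq_zero φ hM₀ (by omega),
    ← sum_range_sum_antidiagonal _ (M := M₀ + (I + N)) _ _ (by omega)]
  · refine Finset.sum_congr rfl fun m _ => ?_
    have := LinearMap.congr_fun (coeff_expSeries_mul_zcoeff (commute_annArg φ φ)
      (commute_creArg ψ ψ) (fun m n hm hn => commutator_annArg_creArg hp φ ψ hm hn) m r) u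
    rw [← annihilation_eq, ← creation_eq, Module.End.mul_apply] at this
    rw [this, LinearMap.sum_apply, map_sum]
    refine Finset.sum_congr rfl fun ij hij => ?_
    rw [← Finset.HasAntidiagonal.mem_antidiagonal.mp hij, LinearMap.smul_apply, map_smul,
      Module.End.mul_apply]
    rw [show ((ij.1 + ij.2 : ℕ) : ℤ) + k = ij.2 + (k + ij.1) by push_cast; ring]
  · intro i j hi
    rw [zcoeff_of_neg (ψ.creation p) (by omega), LinearMap.zero_apply, map_zero, smul_zero]
  · intro i j hj
    rw [coeff_annihilation_eq_zero φ hu hj, map_zero, map_zero, smul_zero]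

/-- The operator product expansion of the oscillator parts. -/
theorem oscMode_oscMode (hp : p.Admissible) (φ ψ : LinField) (k l : ℤ) {N : ℕ} {f : Osc}
    (hf : f ∈ oscFilt N) {I : ℕ} (hI : N + l ≤ I) :
    φ.oscMode p k (ψ.oscMode p l f) = ∑ i ∈ Finset.range I,
      PowerSeries.coeff i (expSeries (φ.contraction p ψ)) •
        normalProd p φ ψ N (k + i) (l - i) f := by
  rw [ψ.oscMode_apply l fun m hm => coeff_annihilation_eq_zero ψ hf hm, map_sum]
  have h : ∀ n ∈ Finset.range N, φ.oscMode p k (zcoeff (ψ.creation p) (n + l)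
      (PowerSeries.coeff n (ψ.annihilation p) f)) = _ := fun n hn =>
    oscMode_zcoeff_creation hp φ ψ k (n + l)
      (oscFilt_mono (Nat.sub_le N n) (coeff_annihilation_mem ψ hf n))
      (show (n : ℤ) + l < I by have := Finset.mem_range.mp hn; omega)
  rw [Finset.sum_congr rfl h, Finset.sum_comm]
  refine Finset.sum_congr rfl fun i _ => ?_
  unfold normalProd
  rw [Finset.sum_comm]
  simp only [LinearMap.sum_apply, Finset.smul_sum, Module.End.mul_apply]
  refine Finset.sum_congr rfl fun m _ => Finset.sum_congr rfl fun n _ => ?_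
  rw [add_sub_assoc]

/-- If `φ(c w) + ψ(w)` has no oscillators, then `:exp φ(z) exp ψ(w):` at `z = c w` has trivial
oscillator part. -/
theorem sum_zpow_smul_normalProd (φ ψ : LinField) {c : ℂ} (hc : c ≠ 0)
    (hcre : ∀ (i : Fin 2) (n : ℕ), n ≠ 0 → c ^ n * φ.osc i (-(n : ℤ)) + ψ.osc i (-(n : ℤ)) = 0)
    (hann : ∀ (i : Fin 2) (n : ℕ), n ≠ 0 → c⁻¹ ^ n * φ.osc i (n : ℤ) + ψ.osc i (n : ℤ) = 0)
    (k l : ℤ) {N : ℕ} {f : Osc} (hf : f ∈ oscFilt N) (J : Finset ℤ)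
    (hJ : ∀ j, -N < k + j → -N < l - j → j ∈ J) :
    ∑ j ∈ J, c ^ j • normalProd p φ ψ N (k + j) (l - j) f =
      if k + l = 0 then c ^ (-k) • f else 0 := by
  have expArg_eq_zero : ∀ x : ℕ → Module.End ℂ Osc, (∀ n, n ≠ 0 → x n = 0) →
      expSeries x = 1 := by
    intro x hx
    rw [← expSeries_zero]
    unfold expSeries
    congr! 8 with k m hm n
    split_ifs with h0
    · rfl
    · exact hx n h0
  -- The creation factors at z = c w multiply to 1, and likewise the annihilation factors in `hA`.
  have hC : expSeries (fun n => c ^ n • φ.creArg p n) * ψ.creation p = 1 := by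
    rw [creation_eq, ← expSeries_add
      (fun i j => ((commute_creArg φ φ i j).smul_right _).smul_left _) (commute_creArg ψ ψ)
      (fun i j => (commute_creArg φ ψ i j).smul_left _)]
    refine expArg_eq_zero _ fun n hn => ?_
    simp only [Pi.add_apply, creArg, Finset.smul_sum, smul_smul, ← Finset.sum_add_distrib,
      ← add_smul, hcre _ n hn, zero_smul, Finset.sum_const_zero]
  have hA : expSeries (fun n => c⁻¹ ^ n • φ.annArg p n) * ψ.annihilation p = 1 := by
    rw [annihilation_eq, ← expSeries_add
      (fun i j => ((commute_annArg φ φ i j).smul_right _).smul_left _) (commute_annArg ψ ψ)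
      (fun i j => (commute_annArg φ ψ i j).smul_left _)]
    refine expArg_eq_zero _ fun n hn => ?_
    simp only [Pi.add_apply, annArg, Finset.smul_sum, smul_smul, ← Finset.sum_add_distrib,
      ← add_smul, hann _ n hn, zero_smul, Finset.sum_const_zero]
  have hzC : ∀ a : ℤ, zcoeff (expSeries (fun n => c ^ n • φ.creArg p n)) a =
      c ^ a • zcoeff (φ.creation p) a := by
    intro a
    unfold zcoeff
    split_ifs with h
    · rw [coeff_expSeries_pow_smul (commute_creArg φ φ), creation_eq, ← zpow_natCast,
        Int.toNat_of_nonneg h]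
    · rw [smul_zero]
  -- For fixed annihilation indices the sum over j is a convolution of creation coefficients, hence
  -- a coefficient of the constant series 1. It forces m + n = -(k + l).
  have hsum : ∀ m ∈ Finset.range N, ∀ n ∈ Finset.range N,
      ∑ j ∈ J, c ^ j • (zcoeff (φ.creation p) (m + (k + j)) * zcoeff (ψ.creation p) (n + (l - j))) =
        c ^ (-(m + k)) • (if (m + k) + (n + l) = 0 then 1 else 0) := by
    intro m hm n hn
    have h1 := Finset.mem_range.mp hm
    have h2 := Finset.mem_range.mp hn
    rw [← zcoeff_one (A := Module.End ℂ Osc), ← hC, ← sum_zcoeff_mul_zcoeff _ _ _ _ J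
      (fun j hj hj' => hJ j (by omega) (by omega)), Finset.smul_sum]
    refine Finset.sum_congr rfl fun j _ => ?_
    rw [hzC, smul_mul_assoc, smul_smul, ← zpow_add₀ hc, add_assoc, add_sub_assoc]
    congr 2
    ring
  have hswap : ∑ j ∈ J, c ^ j • normalProd p φ ψ N (k + j) (l - j) f =
      ∑ m ∈ Finset.range N, ∑ n ∈ Finset.range N,
        (∑ j ∈ J, c ^ j • (zcoeff (φ.creation p) (m + (k + j)) *
          zcoeff (ψ.creation p) (n + (l - j))))
          ((PowerSeries.coeff m (φ.annihilation p) * PowerSeries.coeff n (ψ.annihilation p)) f) := by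
    unfold normalProd
    simp only [LinearMap.sum_apply, Finset.smul_sum, LinearMap.smul_apply, Module.End.mul_apply]
    rw [Finset.sum_comm]
    exact Finset.sum_congr rfl fun m _ => Finset.sum_comm
  rw [hswap, Finset.sum_congr rfl fun m hm => Finset.sum_congr rfl fun n hn => by
    rw [hsum m hm n hn]]
  -- For k + l > 0 no pair m, n ≥ 0 satisfies the constraint. Otherwise the surviving terms form the
  -- coefficient of degree s = -(k + l) in the trivial product of annihilation factors.
  rcases lt_or_ge 0 (k + l) with hkl | hkl
  · rw [if_neg hkl.ne']
    refine Finset.sum_eq_zero fun m _ => Finset.sum_eq_zero fun n _ => ?_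
    rw [if_neg (by omega), smul_zero, LinearMap.zero_apply]
  · obtain ⟨s, hs⟩ := Int.eq_ofNat_of_zero_le (neg_nonneg.mpr hkl)
    have hfin := LinearMap.congr_fun (congrArg (PowerSeries.coeff s) hA) f
    rw [PowerSeries.coeff_mul, LinearMap.sum_apply, PowerSeries.coeff_one] at hfin
    have hR : (if k + l = 0 then c ^ (-k) • f else 0) =
        c ^ (-k) • (if s = 0 then (1 : Module.End ℂ Osc) else 0) f := by
      by_cases h0 : s = 0
      · rw [if_pos h0, if_pos (by omega), Module.End.one_apply]
      · rw [if_neg h0, if_neg (by omega), LinearMap.zero_apply, smul_zero]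
    rw [hR, ← hfin, Finset.smul_sum, ← Finset.sum_product']
    symm
    -- Antidiagonal terms outside the N by N square kill f, since the two annihilation coefficients
    -- commute. Terms of the square off the antidiagonal are zero by the constraint.
    refine Finset.sum_congr_of_eq_on_inter ?_ ?_ ?_
    · intro u hu hnu
      have h1 := Finset.HasAntidiagonal.mem_antidiagonal.mp hu
      rw [coeff_expSeries_pow_smul (commute_annArg φ φ), ← annihilation_eq, smul_mul_assoc,
        LinearMap.smul_apply]
      by_cases h2 : N ≤ u.2
      · rw [Module.End.mul_apply, coeff_annihilation_eq_zero ψ hf h2, map_zero, smul_zero,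
          smul_zero]
      · have h3 : N ≤ u.1 := by
          by_contra h3
          exact hnu (Finset.mem_product.mpr ⟨Finset.mem_range.mpr (not_le.mp h3),
            Finset.mem_range.mpr (not_le.mp h2)⟩)
        rw [(commute_annihilation φ ψ _ _).eq, Module.End.mul_apply,
          coeff_annihilation_eq_zero φ hf h3, map_zero, smul_zero, smul_zero]
    · intro u _ hnu
      rw [if_neg, smul_zero, LinearMap.zero_apply]
      intro h
      exact hnu (Finset.HasAntidiagonal.mem_antidiagonal.mpr (by omega))
    · intro u hu _
      have h1 := Finset.HasAntidiagonal.mem_antidiagonal.mp hu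
      rw [if_pos (by omega), coeff_expSeries_pow_smul (commute_annArg φ φ), ← annihilation_eq,
        smul_mul_assoc, LinearMap.smul_apply, LinearMap.smul_apply, Module.End.one_apply,
        smul_smul, neg_add_rev, zpow_add₀ hc, zpow_neg c u.1, zpow_natCast, inv_pow]

end LinField

/-! ## Vertex operators on the Fock space -/

/-- The data of a vertex operator `X(z)` whose restriction to the sector `n` is
`scalar n • z ^ (expo n) :exp field(z):`, followed by the translation of sectors by `shift`. -/
structure VertexData where
  field : LinField
  scalar : ℤ × ℤ → ℂ
  expo : ℤ × ℤ → ℤ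
  shift : ℤ × ℤ

namespace VertexData

/-- The coefficient of `z ^ k`. -/
def mode (p : Params) (X : VertexData) (k : ℤ) : Module.End ℂ Fock :=
  Finsupp.lsum ℂ fun n : ℤ × ℤ =>
    X.scalar n • (Finsupp.lsingle (n + X.shift) ∘ₗ X.field.oscMode p (k - X.expo n))

theorem mode_single (X : VertexData) (k : ℤ) (n : ℤ × ℤ) (f : Osc) :
    X.mode p k (Finsupp.single n f) =
      X.scalar n • Finsupp.single (n + X.shift) (X.field.oscMode p (k - X.expo n) f) := by
  simp [mode]

/-- The coefficient of `z ^ k w ^ l` in the normally ordered product `:X(z) Y(w):` applied to the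
vector `f` in the sector `n`. -/
def normalPair (p : Params) (X Y : VertexData) (n : ℤ × ℤ) (f : Osc) (N : ℕ) (k l : ℤ) : Fock :=
  (X.scalar n * Y.scalar n) • Finsupp.single (n + X.shift + Y.shift)
    (LinField.normalProd p X.field Y.field N (k - X.expo n) (l - Y.expo n) f)

theorem normalPair_comm (X Y : VertexData) (n : ℤ × ℤ) (f : Osc) (N : ℕ) (k l : ℤ) :
    normalPair p X Y n f N k l = normalPair p Y X n f N l k := by
  unfold normalPair
  rw [LinField.normalProd_comm, mul_comm, add_right_comm]

theorem normalPair_eq_zero_right (X Y : VertexData) (n : ℤ × ℤ) (f : Osc) (N : ℕ) (k : ℤ) {l : ℤ}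
    (hl : l ≤ Y.expo n - N) : normalPair p X Y n f N k l = 0 := by
  unfold normalPair
  rw [LinField.normalProd_eq_zero_right _ _ _ (by omega)]
  simp

theorem normalPair_eq_zero_left (X Y : VertexData) (n : ℤ × ℤ) (f : Osc) (N : ℕ) {k : ℤ} (l : ℤ)
    (hk : k ≤ X.expo n - N) : normalPair p X Y n f N k l = 0 := by
  rw [normalPair_comm, normalPair_eq_zero_right Y X n f N l hk]

/-- The cut-off makes the normal product vanish when either exponent is very negative. Moving along
k + j, l - j it vanishes in both directions, so multiplication by any two-sided series, in
particular a delta function, is a finite sum. -/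
theorem finite_support_smul_normalPair (X Y : VertexData) (n : ℤ × ℤ) (f : Osc) (N : ℕ) (k l : ℤ)
    (d : ℤ → ℂ) :
    (Function.support fun j : ℤ => d j • normalPair p X Y n f N (k + j) (l - j)).Finite := by
  refine (Set.finite_Icc (X.expo n - N - k) (l + N - Y.expo n)).subset fun j hj => ?_
  by_contra h
  refine hj ?_
  simp only
  rw [Set.mem_Icc, not_and_or, not_le, not_le] at h
  rcases h with h | h
  · rw [normalPair_eq_zero_left _ _ _ _ _ _ (by omega), smul_zero]
  · rw [normalPair_eq_zero_right _ _ _ _ _ _ (by omega), smul_zero]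

/-- Translating the sectors by `Y.shift` multiplies `X(z)` by `τ z ^ ρ`. -/
def Twist (X Y : VertexData) (τ : ℂ) (ρ : ℤ) : Prop :=
  ∀ n, X.scalar (n + Y.shift) = τ * X.scalar n ∧ X.expo (n + Y.shift) = X.expo n + ρ

/-- The scalar series in `X(z) Y(w) = S(w / z) :X(z) Y(w):`. -/
def opeSeries (p : Params) (X Y : VertexData) : PowerSeries ℂ :=
  expSeries (X.field.contraction p Y.field)

/-- X acts on the sector already translated by Y, which produces τ and the shift of the exponent by
ρ. The oscillators contribute the series S, and multiplication by (w/z)^i moves the coefficient of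
z^k w^l to the index (k + i, l - i). -/
theorem mode_mode (hp : p.Admissible) {X Y : VertexData} {τ : ℂ} {ρ : ℤ} (h : X.Twist Y τ ρ)
    (n : ℤ × ℤ) {f : Osc} {N : ℕ} (hf : f ∈ oscFilt N) (k l : ℤ) {I : ℕ}
    (hI : N + (l - Y.expo n) ≤ I) :
    X.mode p k (Y.mode p l (Finsupp.single n f)) =
      τ • ∑ i ∈ Finset.range I, PowerSeries.coeff i (opeSeries p X Y) •
        normalPair p X Y n f N (k - ρ + i) (l - i) := by
  rw [mode_single, map_smul, mode_single, (h n).1, (h n).2,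
    LinField.oscMode_oscMode hp _ _ _ _ hf hI, ← Finsupp.lsingle_apply (R := ℂ), map_sum,
    Finset.smul_sum, Finset.smul_sum, Finset.smul_sum]
  refine Finset.sum_congr rfl fun i _ => ?_
  unfold normalPair opeSeries
  rw [map_smul, Finsupp.lsingle_apply, smul_smul, smul_smul, smul_smul, smul_smul,
    add_right_comm n, show k - (X.expo n + ρ) + i = k - ρ + i - X.expo n by ring,
    sub_right_comm l]
  congr 1
  ring

theorem finsum_zcoeff_smul {V : Type*} [AddCommGroup V] [Module ℂ V] (F : PowerSeries ℂ)
    (h : ℤ → V) {I : ℕ} (hI : ∀ i : ℤ, (I : ℤ) ≤ i → h i = 0) :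
    ∑ᶠ j : ℤ, zcoeff F j • h j = ∑ i ∈ Finset.range I, PowerSeries.coeff i F • h i := by
  rw [finsum_eq_sum_of_support_subset (s := (Finset.range I).map Nat.castEmbedding), Finset.sum_map]
  · exact Finset.sum_congr rfl fun i _ => by rw [Nat.castEmbedding_apply, zcoeff_natCast]
  · intro j hj
    have h0 : 0 ≤ j := by
      by_contra hneg
      exact hj (by simp only [zcoeff_of_neg F (not_le.mp hneg), zero_smul])
    have h1 : j < I := by
      by_contra hge
      exact hj (by simp only [hI j (not_lt.mp hge), smul_zero])
    lift j to ℕ using h0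
    simpa using h1

theorem mode_mode_eq_zero (hp : p.Admissible) {X Y : VertexData} {τ : ℂ} {ρ : ℤ}
    (h : X.Twist Y τ ρ) (n : ℤ × ℤ) {f : Osc} {N : ℕ} (hf : f ∈ oscFilt N) (k l : ℤ)
    (hl : N + (l - Y.expo n) ≤ 0) : X.mode p k (Y.mode p l (Finsupp.single n f)) = 0 := by
  rw [mode_mode hp h n hf k l (I := 0) (by simpa using hl), Finset.sum_range_zero, smul_zero]

theorem finite_mode_mode (hp : p.Admissible) {X Y : VertexData} {τ : ℂ} {ρ : ℤ}
    (h : X.Twist Y τ ρ) (n : ℤ × ℤ) (f : Osc) (k l : ℤ) :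
    {i : ℕ | X.mode p (k + i) (Y.mode p (l - i) (Finsupp.single n f)) ≠ 0}.Finite := by
  obtain ⟨N, hf⟩ := exists_mem_oscFilt f
  refine (Set.finite_Iio (N + (l - Y.expo n)).toNat).subset fun i hi => ?_
  by_contra hc
  rw [Set.mem_Iio, not_lt] at hc
  exact hi (mode_mode_eq_zero hp h n hf _ _ (by omega))

theorem finsum_smul_mode_mode (hp : p.Admissible) {X Y : VertexData} {τ : ℂ} {ρ : ℤ}
    (h : X.Twist Y τ ρ) (g : PowerSeries ℂ) (n : ℤ × ℤ) {f : Osc} {N : ℕ} (hf : f ∈ oscFilt N)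
    (k l : ℤ) :
    ∑ᶠ i : ℕ, PowerSeries.coeff i g • X.mode p (k + i) (Y.mode p (l - i) (Finsupp.single n f)) =
      τ • ∑ᶠ j : ℤ, zcoeff (g * opeSeries p X Y) j •
        normalPair p X Y n f N (k - ρ + j) (l - j) := by
  -- From I on, the exponent of w is too low for Y to act nontrivially. The product series needs the
  -- bound I + I because both factors range up to I.
  set I := (N + (l - Y.expo n)).toNat with hI
  rw [finsum_zcoeff_smul _ _ (I := I + I)
      (fun i hi => normalPair_eq_zero_right _ _ _ _ _ _ (by push_cast at hi; omega)),
    finsum_eq_sum_of_support_subset (s := Finset.range I)]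
  · have e1 : ∀ i ∈ Finset.range I, PowerSeries.coeff i g •
        X.mode p (k + i) (Y.mode p (l - i) (Finsupp.single n f)) =
        τ • ∑ j ∈ Finset.range I, (PowerSeries.coeff i g * PowerSeries.coeff j (opeSeries p X Y)) •
          normalPair p X Y n f N (k - ρ + (i + j : ℕ)) (l - (i + j : ℕ)) := by
      intro i _
      rw [mode_mode hp h n hf _ _ (I := I) (by omega), smul_comm, Finset.smul_sum]
      congr 1
      refine Finset.sum_congr rfl fun j _ => ?_
      rw [smul_smul]
      congr 2
      · push_cast; ring
      · push_cast; ring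
    rw [Finset.sum_congr rfl e1, ← Finset.smul_sum]
    congr 1
    rw [← sum_range_sum_antidiagonal (fun i j => (PowerSeries.coeff i g *
      PowerSeries.coeff j (opeSeries p X Y)) •
          normalPair p X Y n f N (k - ρ + (i + j : ℕ)) (l - (i + j : ℕ))) (M := I + I) _ _ le_rfl]
    · refine Finset.sum_congr rfl fun m _ => ?_
      rw [PowerSeries.coeff_mul, Finset.sum_smul]
      refine Finset.sum_congr rfl fun ij hij => ?_
      rw [Finset.HasAntidiagonal.mem_antidiagonal.mp hij]
    · intro i j hi
      rw [normalPair_eq_zero_right _ _ _ _ _ _ (by push_cast; omega), smul_zero]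
    · intro i j hj
      rw [normalPair_eq_zero_right _ _ _ _ _ _ (by push_cast; omega), smul_zero]
  · intro i hi
    rw [Finset.coe_range, Set.mem_Iio]
    by_contra hc
    refine hi ?_
    simp only
    rw [mode_mode_eq_zero hp h n hf _ _ (by omega), smul_zero]

/-- The coefficient of `z ^ k w ^ l` in `g(w / z) X(z) Y(w) - g(z / w) Y(w) X(z)` applied to `v`. -/
def defect (p : Params) (g : PowerSeries ℂ) (X Y : VertexData) (k l : ℤ) (v : Fock) : Fock :=
  (∑ᶠ i : ℕ, PowerSeries.coeff i g • X.mode p (k + i) (Y.mode p (l - i) v)) -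
    ∑ᶠ i : ℕ, PowerSeries.coeff i g • Y.mode p (l + i) (X.mode p (k - i) v)

/-- When g·S is palindromic of degree ρ, the factor z^ρ (g·S)(w/z) is symmetric in z and w. The
normal product is symmetric as well. -/
theorem defect_self (hp : p.Admissible) {X : VertexData} {τ : ℂ} {ρ : ℤ} (h : X.Twist X τ ρ)
    (g : PowerSeries ℂ) (hg : ∀ j, zcoeff (g * opeSeries p X X) (ρ - j) =
      zcoeff (g * opeSeries p X X) j) (k l : ℤ) (n : ℤ × ℤ) (f : Osc) :
    defect p g X X k l (Finsupp.single n f) = 0 := by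
  obtain ⟨N, hf⟩ := exists_mem_oscFilt f
  unfold defect
  rw [finsum_smul_mode_mode hp h g n hf k l, finsum_smul_mode_mode hp h g n hf l k]
  refine sub_eq_zero.mpr (congrArg (τ • ·) ?_)
  refine finsum_eq_of_bijective (fun j => ρ - j) (Equiv.subLeft ρ).bijective fun j => ?_
  rw [hg, normalPair_comm, show l - ρ + (ρ - j) = l - j by ring,
    show k - (ρ - j) = k - ρ + j by ring]

/-- Both orders multiply the same normal product, one by an expansion in w/z and the other by an
expansion in z/w. The two-sided series d is their difference. -/
theorem defect_eq (hp : p.Admissible) {X Y : VertexData} {τ τ' : ℂ} (h : X.Twist Y τ 0)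
    (h' : Y.Twist X τ' 0) (g : PowerSeries ℂ) (d : ℤ → ℂ)
    (hd : ∀ j, τ * zcoeff (g * opeSeries p X Y) j - τ' * zcoeff (g * opeSeries p Y X) (-j) = d j)
    (k l : ℤ) (n : ℤ × ℤ) {f : Osc} {N : ℕ} (hf : f ∈ oscFilt N) :
    defect p g X Y k l (Finsupp.single n f) =
      ∑ᶠ j : ℤ, d j • normalPair p X Y n f N (k + j) (l - j) := by
  rw [defect, finsum_smul_mode_mode hp h g n hf, finsum_smul_mode_mode hp h' g n hf, smul_finsum,
    smul_finsum]
  have e : ∑ᶠ j : ℤ, τ' • zcoeff (g * opeSeries p Y X) j •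
      normalPair p Y X n f N (l - 0 + j) (k - j) =
      ∑ᶠ j : ℤ, (τ' * zcoeff (g * opeSeries p Y X) (-j)) •
        normalPair p X Y n f N (k + j) (l - j) := by
    refine finsum_eq_of_bijective (fun j => -j) neg_involutive.bijective fun j => ?_
    rw [neg_neg, smul_smul, normalPair_comm]
    congr 2
    all_goals ring
  simp only [sub_zero, smul_smul] at e ⊢
  rw [e, ← finsum_sub_distrib (finite_support_smul_normalPair X Y n f N k l _)
    (finite_support_smul_normalPair X Y n f N k l _)]
  refine finsum_congr fun j => ?_
  rw [← sub_smul, hd]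

/-- The delta functions in `g(w / z) X(z) Y(w) - g(z / w) Y(w) X(z)` supported at `z = w` cancel
against those of the same expression with `X` and `Y` interchanged. -/
theorem defect_add_defect (hp : p.Admissible) {X Y : VertexData} {τ τ' : ℂ} (h : X.Twist Y τ 0)
    (h' : Y.Twist X τ' 0) (g : PowerSeries ℂ) (α β c : ℂ)
    (hd : ∀ j, τ * zcoeff (g * opeSeries p X Y) j - τ' * zcoeff (g * opeSeries p Y X) (-j) =
      α + β * c ^ j) (k l : ℤ) (n : ℤ × ℤ) {f : Osc} {N : ℕ} (hf : f ∈ oscFilt N) :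
    defect p g X Y k l (Finsupp.single n f) + defect p g Y X k l (Finsupp.single n f) =
      β • (∑ᶠ j : ℤ, c ^ j • normalPair p X Y n f N (k + j) (l - j)) -
        β • ∑ᶠ j : ℤ, c ^ j • normalPair p X Y n f N (l + j) (k - j) := by
  have hd' : ∀ j, τ' * zcoeff (g * opeSeries p Y X) j - τ * zcoeff (g * opeSeries p X Y) (-j) =
      -(α + β * c ^ (-j)) := by
    intro j
    rw [← hd, neg_neg]
    ring
  rw [defect_eq hp h h' g _ hd k l n hf, defect_eq hp h' h g _ hd' k l n hf]
  have e1 : ∑ᶠ j : ℤ, -(α + β * c ^ (-j)) • normalPair p Y X n f N (k + j) (l - j) =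
      ∑ᶠ j : ℤ, -(α + β * c ^ j) • normalPair p X Y n f N (l + j) (k - j) := by
    refine finsum_eq_of_bijective (fun j => -j) neg_involutive.bijective fun j => ?_
    rw [normalPair_comm]
    congr 2; ring
  -- Multiplication by δ(w/z) gives a sum that depends only on k + l, so it does not change under
  -- exchange of k and l.
  have e2 : ∑ᶠ j : ℤ, α • normalPair p X Y n f N (k + j) (l - j) =
      ∑ᶠ j : ℤ, α • normalPair p X Y n f N (l + j) (k - j) := by
    refine finsum_eq_of_bijective (fun j => k - l + j) (Equiv.addLeft (k - l)).bijective
      fun j => ?_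
    congr 2
    all_goals ring
  have e3 : ∀ k l : ℤ, ∑ᶠ j : ℤ, (α + β * c ^ j) • normalPair p X Y n f N (k + j) (l - j) =
      ∑ᶠ j : ℤ, α • normalPair p X Y n f N (k + j) (l - j) +
        β • ∑ᶠ j : ℤ, c ^ j • normalPair p X Y n f N (k + j) (l - j) := by
    intro k l
    rw [smul_finsum]
    simp only [smul_smul]
    rw [← finsum_add_distrib (finite_support_smul_normalPair X Y n f N k l _)
      (finite_support_smul_normalPair X Y n f N k l _)]
    exact finsum_congr fun j => add_smul _ _ _
  have e4 : ∑ᶠ j : ℤ, -(α + β * c ^ j) • normalPair p X Y n f N (l + j) (k - j) =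
      -∑ᶠ j : ℤ, (α + β * c ^ j) • normalPair p X Y n f N (l + j) (k - j) := by
    rw [← finsum_neg_distrib]
    exact finsum_congr fun j => neg_smul _ _
  rw [e1, e4, e3, e3, e2]
  abel

end VertexData

/-! ## The quadratic relation for sums of vertex operators -/

/-- Finiteness on single-sector vectors extends to all vectors by linearity, and only then may the
infinite sums be added termwise. The second finiteness claim is the first with m and n exchanged. -/
theorem quadraticRelation_of_single {T : ℤ → Module.End ℂ Fock} {g : PowerSeries ℂ} {C c : ℂ}
    (hfin : ∀ (m n : ℤ) (s : ℤ × ℤ) (f : Osc),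
      {l : ℕ | T (m - l) (T (n + l) (Finsupp.single s f)) ≠ 0}.Finite)
    (h : ∀ (m n : ℤ) (s : ℤ × ℤ) (f : Osc),
      (∑ᶠ l : ℕ, PowerSeries.coeff l g • T (m - l) (T (n + l) (Finsupp.single s f))) -
        (∑ᶠ l : ℕ, PowerSeries.coeff l g • T (n - l) (T (m + l) (Finsupp.single s f))) =
      (C * (deltaCoeff c⁻¹ m n - deltaCoeff c m n)) • Finsupp.single s f) :
    QuadraticRelation T g C c := by
  have hfin' : ∀ (m n : ℤ) (v : Fock), {l : ℕ | T (m - l) (T (n + l) v) ≠ 0}.Finite := by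
    intro m n v
    induction v using Finsupp.induction_linear with
    | zero => simp
    | add v w hv hw =>
      refine (hv.union hw).subset fun l hl => ?_
      by_contra hc
      simp only [Set.mem_union, Set.mem_ofPred_eq, not_or, not_not] at hc
      exact hl (by rw [map_add, map_add, hc.1, hc.2, add_zero])
    | single s f => exact hfin m n s f
  have hsupp : ∀ (m n : ℤ) (v : Fock), (Function.support fun l : ℕ =>
      PowerSeries.coeff l g • T (m - l) (T (n + l) v)).Finite := fun m n v =>
    (hfin' m n v).subset fun l hl hc => hl (by simp only [hc, smul_zero])
  intro m n v
  refine ⟨hfin' m n v, hfin' n m v, ?_⟩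
  induction v using Finsupp.induction_linear with
  | zero => simp
  | add v w hv hw =>
    simp only [map_add, smul_add]
    rw [finsum_add_distrib (hsupp m n v) (hsupp m n w), finsum_add_distrib (hsupp n m v)
      (hsupp n m w), ← hv, ← hw]
    abel
  | single s f => exact h m n s f

theorem quadraticRelation_sum {p : Params} (hp : p.Admissible) {ι : Type} [Fintype ι]
    (X : ι → VertexData) (τ : ι → ι → ℂ) (ρ : ι → ι → ℤ)
    (hτ : ∀ i j, (X i).Twist (X j) (τ i j) (ρ i j)) {g : PowerSeries ℂ} {C c : ℂ}
    (h : ∀ (k l : ℤ) (s : ℤ × ℤ) (f : Osc),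
      ∑ i, ∑ j, VertexData.defect p g (X i) (X j) k l (Finsupp.single s f) =
        (C * (deltaCoeff c⁻¹ (-k) (-l) - deltaCoeff c (-k) (-l))) • Finsupp.single s f) :
    QuadraticRelation (fun m => ∑ i, (X i).mode p (-m)) g C c := by
  have hexp : ∀ (m n : ℤ) (s : ℤ × ℤ) (f : Osc) (l : ℕ),
      (∑ i, (X i).mode p (-(m - l))) ((∑ i, (X i).mode p (-(n + l))) (Finsupp.single s f)) =
        ∑ i, ∑ j, (X i).mode p (-m + l) ((X j).mode p (-n - l) (Finsupp.single s f)) := by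
    intro m n s f l
    rw [LinearMap.sum_apply, neg_sub, sub_eq_neg_add, neg_add']
    refine Finset.sum_congr rfl fun i _ => ?_
    rw [LinearMap.sum_apply, map_sum]
  have hfin : ∀ (m n : ℤ) (s : ℤ × ℤ) (f : Osc) (i j : ι),
      (Function.support fun l : ℕ => PowerSeries.coeff l g •
        (X i).mode p (-m + l) ((X j).mode p (-n - l) (Finsupp.single s f))).Finite :=
    fun m n s f i j => (VertexData.finite_mode_mode hp (hτ i j) s f (-m) (-n)).subset
      fun l hl hc => hl (by simp only [hc, smul_zero])
  have hsum : ∀ (m n : ℤ) (s : ℤ × ℤ) (f : Osc),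
      ∑ᶠ l : ℕ, PowerSeries.coeff l g • ∑ i, ∑ j,
        (X i).mode p (-m + l) ((X j).mode p (-n - l) (Finsupp.single s f)) =
      ∑ i, ∑ j, ∑ᶠ l : ℕ, PowerSeries.coeff l g •
        (X i).mode p (-m + l) ((X j).mode p (-n - l) (Finsupp.single s f)) := by
    intro m n s f
    simp only [Finset.smul_sum]
    rw [finsum_sum_comm]
    · refine Finset.sum_congr rfl fun i _ => ?_
      rw [finsum_sum_comm]
      exact fun j _ => hfin m n s f i j
    · intro i _
      refine ((Set.finite_univ (α := ι)).biUnion fun j _ => hfin m n s f i j).subset fun l hl => ?_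
      obtain ⟨j, _, hj⟩ := Finset.exists_ne_zero_of_sum_ne_zero hl
      exact Set.mem_biUnion (Set.mem_univ j) hj
  refine quadraticRelation_of_single ?_ ?_
  · intro m n s f
    refine ((Set.finite_univ (α := ι × ι)).biUnion fun ij _ =>
      VertexData.finite_mode_mode hp (hτ ij.1 ij.2) s f (-m) (-n)).subset fun l hl => ?_
    rw [Set.mem_ofPred_eq, hexp] at hl
    obtain ⟨i, _, hi⟩ := Finset.exists_ne_zero_of_sum_ne_zero hl
    obtain ⟨j, _, hj⟩ := Finset.exists_ne_zero_of_sum_ne_zero hi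
    exact Set.mem_biUnion (Set.mem_univ (i, j)) hj
  · intro m n s f
    have := h (-m) (-n) s f
    rw [neg_neg, neg_neg] at this
    rw [← this]
    simp only [hexp, hsum]
    -- A defect pairs X_i X_j with X_j X_i, so the two summation indices are exchanged in the second
    -- product.
    rw [Finset.sum_comm (f := fun i j => ∑ᶠ l : ℕ, PowerSeries.coeff l g •
        (X i).mode p (-n + l) ((X j).mode p (-m - l) (Finsupp.single s f)))]
    simp only [← Finset.sum_sub_distrib]
    rfl

/-! ## Explicit scalar series -/

section Scalar

theorem expSeries_congr {A : Type*} [Ring A] [Algebra ℂ A] {x y : ℕ → A}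
    (h : ∀ n, n ≠ 0 → x n = y n) : expSeries x = expSeries y := by
  have : (fun n => if n = 0 then 0 else x n) = fun n => if n = 0 then 0 else y n := by
    funext n
    split_ifs with h0
    · rfl
    · exact h n h0
  unfold expSeries
  rw [this]

theorem expSeries_add_complex (x y : ℕ → ℂ) :
    expSeries (x + y) = expSeries x * expSeries y :=
  expSeries_add (fun _ _ => Commute.all _ _) (fun _ _ => Commute.all _ _)
    (fun _ _ => Commute.all _ _)

/-- The logarithm series of 1 - u X: both sides have constant term 1 and the same logarithmic
derivative. -/
theorem expSeries_neg_pow_div (u : ℂ) :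
    expSeries (fun n => -u ^ n / n) = 1 - PowerSeries.C u * PowerSeries.X := by
  refine euler_ext (coeff_zero_euler _) (euler_expSeries fun _ _ => Commute.all _ _) ?_ ?_
  · ext n
    rw [mul_sub, mul_one, map_sub, mul_left_comm, PowerSeries.coeff_C_mul]
    rcases n with _ | _ | n
    · simp [coeff_euler]
    · rw [coeff_euler, coeff_euler_expArg, PowerSeries.coeff_succ_mul_X, coeff_zero_euler]
      simp
    · rw [coeff_euler, coeff_euler_expArg, PowerSeries.coeff_succ_mul_X, coeff_euler_expArg]
      have h1 : ((n + 1 + 1 : ℕ) : ℂ) ≠ 0 := Nat.cast_ne_zero.mpr (Nat.succ_ne_zero _)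
      have h2 : ((n + 1 : ℕ) : ℂ) ≠ 0 := Nat.cast_ne_zero.mpr (Nat.succ_ne_zero _)
      rw [smul_eq_mul, smul_eq_mul, smul_eq_mul, mul_div_cancel₀ _ h1, mul_div_cancel₀ _ h2,
        map_sub, PowerSeries.coeff_one, PowerSeries.coeff_C_mul, PowerSeries.coeff_X,
        if_neg (by omega), if_neg (by omega)]
      ring
  · rw [coeff_zero_expSeries]
    simp

theorem expSeries_pow_div_mul (u : ℂ) :
    expSeries (fun n => u ^ n / n) * (1 - PowerSeries.C u * PowerSeries.X) = 1 := by
  rw [← expSeries_neg_pow_div, ← expSeries_add_complex, ← expSeries_zero]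
  refine expSeries_congr fun n _ => ?_
  simp only [Pi.add_apply, Pi.zero_apply]
  ring

theorem geometric_mul (c : ℂ) :
    PowerSeries.mk (fun n => c ^ n) * (1 - PowerSeries.C c * PowerSeries.X) = 1 := by
  ext n
  rw [mul_sub, mul_one, mul_left_comm, map_sub, PowerSeries.coeff_C_mul, PowerSeries.coeff_mk,
    PowerSeries.coeff_one]
  cases n with
  | zero => simp
  | succ n =>
    rw [PowerSeries.coeff_succ_mul_X, PowerSeries.coeff_mk, if_neg (Nat.succ_ne_zero n)]
    ring

theorem expSeries_pow_div (u : ℂ) :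
    expSeries (fun n => u ^ n / n) = PowerSeries.mk fun n => u ^ n := by
  have h := (geometric_mul u)
  calc _ = expSeries (fun n => u ^ n / n) * ((1 - PowerSeries.C u * PowerSeries.X) *
        PowerSeries.mk fun n => u ^ n) := by rw [mul_comm (1 - _), h, mul_one]
    _ = _ := by rw [← mul_assoc, expSeries_pow_div_mul, one_mul]

/-- The coefficients of `(1 - u X) / (1 - X)`. -/
theorem zcoeff_expSeries_one_pole (u : ℂ) (j : ℤ) :
    zcoeff (expSeries fun n => (1 - u ^ n) / n) j =
      if 0 < j then 1 - u else if j = 0 then 1 else 0 := by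
  have h : (expSeries fun n : ℕ => (1 - u ^ n) / (n : ℂ)) =
      PowerSeries.C u + PowerSeries.C (1 - u) * PowerSeries.mk fun n => 1 ^ n := by
    have h1 : (expSeries fun n : ℕ => (1 - u ^ n) / (n : ℂ)) =
        expSeries (fun n => (1 : ℂ) ^ n / n) * expSeries (fun n => -u ^ n / n) := by
      rw [← expSeries_add_complex]
      refine expSeries_congr fun n _ => ?_
      simp only [Pi.add_apply]
      ring
    have h2 := geometric_mul 1
    rw [h1, expSeries_pow_div, expSeries_neg_pow_div]
    rw [map_sub, map_one]
    rw [map_one, one_mul] at h2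
    linear_combination PowerSeries.C u * h2
  rw [h]
  rcases lt_trichotomy j 0 with hj | rfl | hj
  · rw [zcoeff_of_neg _ hj, if_neg (by omega), if_neg (by omega)]
  · simp [zcoeff]
  · lift j to ℕ using hj.le
    rw [zcoeff_natCast, map_add,
      PowerSeries.coeff_C_mul, PowerSeries.coeff_mk, PowerSeries.coeff_C,
      if_neg (by omega), if_pos hj]
    simp

/-- The coefficients of `(1 - u X) (1 - v X) / ((1 - X) (1 - u v X))`. -/
theorem zcoeff_expSeries_two_poles {u v c : ℂ} (hc : c = u * v) (hc1 : c ≠ 1) (j : ℤ) :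
    zcoeff (expSeries fun n => (1 + c ^ n - u ^ n - v ^ n) / n) j =
      if 0 < j then (1 - u) * (1 - v) / (1 - c) * (1 - c ^ j) else if j = 0 then 1 else 0 := by
  set α := (1 - u) * (1 - v) / (1 - c) with hα
  have hα' : α * (1 - c) = (1 - u) * (1 - v) := div_mul_cancel₀ _ (sub_ne_zero.mpr hc1.symm)
  -- Partial fractions. Since c = u v, numerator and denominator agree in degrees 0 and 2, so the
  -- residues at the two poles are opposite and the constant part is 1.
  have h : (expSeries fun n : ℕ => (1 + c ^ n - u ^ n - v ^ n) / (n : ℂ)) =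
      1 + PowerSeries.C α * ((PowerSeries.mk fun n => 1 ^ n) - PowerSeries.mk fun n => c ^ n) := by
    have h1 : (expSeries fun n : ℕ => (1 + c ^ n - u ^ n - v ^ n) / (n : ℂ)) =
        expSeries (fun n => (1 : ℂ) ^ n / n) * expSeries (fun n => c ^ n / n) *
          (expSeries (fun n => -u ^ n / n) * expSeries (fun n => -v ^ n / n)) := by
      rw [← expSeries_add_complex, ← expSeries_add_complex, ← expSeries_add_complex]
      refine expSeries_congr fun n _ => ?_
      simp only [Pi.add_apply]
      ring
    have h2 := geometric_mul 1
    have h3 := geometric_mul c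
    rw [h1, expSeries_pow_div, expSeries_pow_div, expSeries_neg_pow_div, expSeries_neg_pow_div]
    rw [map_one, one_mul] at h2
    have h4 : PowerSeries.C α * (1 - PowerSeries.C c) =
        (1 - PowerSeries.C u) * (1 - PowerSeries.C v) := by
      simp only [← map_one PowerSeries.C, ← map_sub, ← map_mul, hα']
    have h5 : (PowerSeries.C c : PowerSeries ℂ) = PowerSeries.C u * PowerSeries.C v := by
      rw [← map_mul, hc]
    generalize PowerSeries.mk (fun n : ℕ => (1 : ℂ) ^ n) = g₁ at *
    generalize PowerSeries.mk (fun n : ℕ => c ^ n) = g₂ at *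
    generalize (PowerSeries.X : PowerSeries ℂ) = X at *
    generalize (PowerSeries.C c : PowerSeries ℂ) = c at *
    generalize (PowerSeries.C u : PowerSeries ℂ) = u at *
    generalize (PowerSeries.C v : PowerSeries ℂ) = v at *
    generalize (PowerSeries.C α : PowerSeries ℂ) = α at *
    have e1 : (1 - u * X) * (1 - v * X) = (1 - X) * (1 - c * X) +
        α * ((1 - c * X) - (1 - X)) := by
      linear_combination -X * h4 - (X ^ 2 - X) * h5
    rw [e1]
    linear_combination (g₂ * (1 - c * X) - α * g₂) * h2 + (1 + α * g₁) * h3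
  rw [h]
  rcases lt_trichotomy j 0 with hj | rfl | hj
  · rw [zcoeff_of_neg _ hj, if_neg (by omega), if_neg (by omega)]
  · simp [zcoeff]
  · lift j to ℕ using hj.le
    rw [zcoeff_natCast, map_add,
      PowerSeries.coeff_C_mul, map_sub, PowerSeries.coeff_mk, PowerSeries.coeff_mk,
      PowerSeries.coeff_one, if_neg (by omega), if_pos hj, zpow_natCast]
    simp

/-- The polynomial `(1 - u X) (1 - u⁻¹ X) (1 - v X) (1 - v⁻¹ X)` is palindromic. -/
theorem zcoeff_expSeries_palindromic {u v : ℂ} (hu : u ≠ 0) (hv : v ≠ 0) (j : ℤ) :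
    zcoeff (expSeries fun n => -(u ^ n + u⁻¹ ^ n + v ^ n + v⁻¹ ^ n) / n) (4 - j) =
      zcoeff (expSeries fun n => -(u ^ n + u⁻¹ ^ n + v ^ n + v⁻¹ ^ n) / n) j := by
  have h : (expSeries fun n : ℕ => -(u ^ n + u⁻¹ ^ n + v ^ n + v⁻¹ ^ n) / (n : ℂ)) =
      1 - PowerSeries.C (u + u⁻¹ + v + v⁻¹) * PowerSeries.X ^ 1 +
        PowerSeries.C (2 + (u + u⁻¹) * (v + v⁻¹)) * PowerSeries.X ^ 2 -
        PowerSeries.C (u + u⁻¹ + v + v⁻¹) * PowerSeries.X ^ 3 +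
        PowerSeries.X ^ 4 := by
    have h1 : (expSeries fun n : ℕ => -(u ^ n + u⁻¹ ^ n + v ^ n + v⁻¹ ^ n) / (n : ℂ)) =
        expSeries (fun n => -u ^ n / n) * expSeries (fun n => -u⁻¹ ^ n / n) *
          (expSeries (fun n => -v ^ n / n) * expSeries (fun n => -v⁻¹ ^ n / n)) := by
      rw [← expSeries_add_complex, ← expSeries_add_complex, ← expSeries_add_complex]
      refine expSeries_congr fun n _ => ?_
      simp only [Pi.add_apply]
      ring
    have h2 : (PowerSeries.C u * PowerSeries.C u⁻¹ : PowerSeries ℂ) = 1 := by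
      rw [← map_mul, mul_inv_cancel₀ hu, map_one]
    have h3 : (PowerSeries.C v * PowerSeries.C v⁻¹ : PowerSeries ℂ) = 1 := by
      rw [← map_mul, mul_inv_cancel₀ hv, map_one]
    rw [h1]
    simp only [expSeries_neg_pow_div, map_add, map_mul, map_ofNat]
    generalize (PowerSeries.X : PowerSeries ℂ) = X at *
    generalize (PowerSeries.C u : PowerSeries ℂ) = a at *
    generalize (PowerSeries.C u⁻¹ : PowerSeries ℂ) = a' at *
    generalize (PowerSeries.C v : PowerSeries ℂ) = b at *
    generalize (PowerSeries.C v⁻¹ : PowerSeries ℂ) = b' at *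
    linear_combination (X ^ 2 * (1 - b * X) * (1 - b' * X)) * h2 +
      (X ^ 2 * (1 - a * X - a' * X + X ^ 2)) * h3
  rw [h]
  generalize u + u⁻¹ + v + v⁻¹ = s
  generalize 2 + (u + u⁻¹) * (v + v⁻¹) = t
  rcases lt_or_ge j 0 with hj | hj
  · rw [zcoeff_of_neg _ hj, zcoeff, if_pos (by omega)]
    simp only [map_add, map_sub, PowerSeries.coeff_C_mul, PowerSeries.coeff_X_pow,
      PowerSeries.coeff_one]
    rw [if_neg (by omega), if_neg (by omega), if_neg (by omega), if_neg (by omega),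
      if_neg (by omega)]
    ring
  · rcases lt_or_ge 4 j with hj' | hj'
    · rw [zcoeff_of_neg _ (by omega : 4 - j < 0), zcoeff, if_pos (by omega)]
      simp only [map_add, map_sub, PowerSeries.coeff_C_mul, PowerSeries.coeff_X_pow,
        PowerSeries.coeff_one]
      rw [if_neg (by omega), if_neg (by omega), if_neg (by omega), if_neg (by omega),
        if_neg (by omega)]
      ring
    · interval_cases j <;> simp [zcoeff, PowerSeries.coeff_X_pow, PowerSeries.coeff_one]

end Scalar

/-! ## The four vertex operators -/

variable (p)

/-- The exponent of `Λ^±_i(z)`, where the sign is that of `s = ±1`. -/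
def lambdaSign (s : ℤ) (i : Fin 2) : LinField where
  charge := Pi.single i s
  logz := Pi.single i s
  const := Pi.single i (-p.logq)
  zeta := s * p.logq₁
  osc j n := if j = i then -(s * p.q ^ (s * n) / n) else 0

theorem lambdaPlus_eq (i : Fin 2) : lambdaPlus p i = lambdaSign p 1 i := by
  simp [lambdaPlus, lambdaSign]

theorem lambdaMinus_eq (i : Fin 2) : lambdaMinus p i = lambdaSign p (-1) i := by
  simp [lambdaMinus, lambdaSign, neg_div]

/-- The exponent of `:Λ^s_1(ξ z) Λ^t_2(z):`, `ξ = exp L`. -/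
def pairField (L : ℂ) (s t : ℤ) : LinField := (lambdaSign p s 0).rescale L + lambdaSign p t 1

theorem pairField_osc_zero (L : ℂ) (s t n : ℤ) :
    (pairField p L s t).osc 0 n = -(s * p.q ^ (s * n) / n) * Complex.exp L ^ (-n) := by
  change (if (0 : Fin 2) = 0 then -(s * p.q ^ (s * n) / n) else 0) * Complex.exp L ^ (-n) +
    (if (0 : Fin 2) = 1 then -(t * p.q ^ (t * n) / n) else 0) = _
  simp

theorem pairField_osc_one (L : ℂ) (s t n : ℤ) :
    (pairField p L s t).osc 1 n = -(t * p.q ^ (t * n) / n) := by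
  change (if (1 : Fin 2) = 0 then -(s * p.q ^ (s * n) / n) else 0) * Complex.exp L ^ (-n) +
    (if (1 : Fin 2) = 1 then -(t * p.q ^ (t * n) / n) else 0) = _
  simp

theorem pairField_zExponent (L : ℂ) {s t h : ℤ} (hst : s - t = 2 * h) (n : ℤ × ℤ) :
    (pairField p L s t).zExponent n = (h * (n.1 - n.2) : ℤ) := by
  have h0 : (pairField p L s t).logz 0 = s := by
    change (Pi.single 0 s : Fin 2 → ℤ) 0 + (Pi.single 1 t : Fin 2 → ℤ) 0 = s
    simp
  have h1 : (pairField p L s t).logz 1 = t := by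
    change (Pi.single 0 s : Fin 2 → ℤ) 1 + (Pi.single 1 t : Fin 2 → ℤ) 1 = t
    simp
  have h2 : (s : ℚ) - t = 2 * h := by exact_mod_cast hst
  rw [LinField.zExponent, Fin.sum_univ_two, h0, h1]
  simp only [bosonZero, if_true, one_ne_zero, if_false]
  push_cast
  linear_combination ((n.1 : ℚ) - n.2) / 2 * h2

/-- The two constants -log q cancel because b_{2,0} = -b_{1,0}. Only the rescaling of colour 1 and
the ζ part survive. -/
theorem pairField_zeroScalar (L : ℂ) (s t : ℤ) (n : ℤ × ℤ) :
    (pairField p L s t).zeroScalar p n =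
      Complex.exp (s * L * (n.1 - n.2) / 2 + (s + t) * p.logq₁ * zetaZero p) := by
  have h0 : (pairField p L s t).const 0 = -p.logq + s * L := by
    change (Pi.single 0 (-p.logq) : Fin 2 → ℂ) 0 + ((Pi.single 0 s : Fin 2 → ℤ) 0 : ℤ) * L +
      (Pi.single 1 (-p.logq) : Fin 2 → ℂ) 0 = _
    simp
  have h1 : (pairField p L s t).const 1 = -p.logq := by
    change (Pi.single 0 (-p.logq) : Fin 2 → ℂ) 1 + ((Pi.single 0 s : Fin 2 → ℤ) 1 : ℤ) * L +
      (Pi.single 1 (-p.logq) : Fin 2 → ℂ) 1 = _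
    simp
  have h2 : (pairField p L s t).zeta = s * p.logq₁ + t * p.logq₁ := rfl
  rw [LinField.zeroScalar, Fin.sum_univ_two, h0, h1, h2]
  simp only [bosonZero, if_true, one_ne_zero, if_false]
  congr 1
  push_cast
  ring

theorem pairField_shift (L : ℂ) {s t h : ℤ} (hst : s - t = 2 * h) (n : ℤ × ℤ) :
    (pairField p L s t).shift n = n + (2 * h, -(2 * h)) := by
  have h0 : (pairField p L s t).charge 0 = s := by
    change (Pi.single 0 s : Fin 2 → ℤ) 0 + (Pi.single 1 t : Fin 2 → ℤ) 0 = s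
    simp
  have h1 : (pairField p L s t).charge 1 = t := by
    change (Pi.single 0 s : Fin 2 → ℤ) 1 + (Pi.single 1 t : Fin 2 → ℤ) 1 = t
    simp
  rw [LinField.shift, h0, h1, hst, sub_eq_add_neg]
  rfl

/-- The vertex operator `c z ^ e :Λ^s_1(ξ z) Λ^t_2(z):`, `ξ = exp L`, for `s - t = 2 h`. -/
def pairVertex (L : ℂ) (s t h : ℤ) (c : ℂ) (e : ℤ) : VertexData where
  field := pairField p L s t
  scalar n := c * Complex.exp (s * L * (n.1 - n.2) / 2 + (s + t) * p.logq₁ * zetaZero p)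
  expo n := e + h * (n.1 - n.2)
  shift := (2 * h, -(2 * h))

/-- As s - t is even, the zero-mode power of z is integral on every sector. The fractional-part
condition then always holds, and rational exponents can be replaced by integers. -/
theorem smul_normalExp_eq_mode (L : ℂ) {s t h : ℤ} (hst : s - t = 2 * h) (c : ℂ) (e k : ℤ)
    {r : ℚ} (hr : r = k - e) :
    c • (pairField p L s t).normalExp p r = (pairVertex p L s t h c e).mode p k := by
  refine Finsupp.lhom_ext fun n f => ?_
  have h1 : r - (pairField p L s t).zExponent n = ((k - (e + h * (n.1 - n.2)) : ℤ) : ℚ) := by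
    rw [pairField_zExponent p L hst, hr]
    push_cast
    ring
  rw [VertexData.mode_single, LinearMap.smul_apply, LinField.normalExp, Finsupp.lsum_single,
    if_pos (by rw [h1, Int.fract_intCast]), h1, Int.floor_intCast, LinearMap.smul_apply, smul_smul,
    pairField_zeroScalar, pairField_shift p L hst]
  rfl

/-- The translation (2h', -2h') changes n₁ - n₂ by 4h', on which both the scalar and the exponent
depend linearly in the exponent. -/
theorem pairVertex_twist (L : ℂ) (s t h : ℤ) (c : ℂ) (e : ℤ) (s' t' h' : ℤ) (c' : ℂ) (e' : ℤ) :
    (pairVertex p L s t h c e).Twist (pairVertex p L s' t' h' c' e')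
      (Complex.exp L ^ (2 * s * h')) (4 * h * h') := by
  intro n
  constructor
  · rw [← Complex.exp_int_mul]
    simp only [pairVertex, Prod.fst_add, Prod.snd_add]
    rw [mul_left_comm, ← Complex.exp_add]
    congr 2
    push_cast
    ring
  · simp only [pairVertex, Prod.fst_add, Prod.snd_add]
    ring

/-! ## Contractions -/

variable {p}

/-- The denominator 1 + q₂^{-n} left by the decoupling cancels the same factor in the Heisenberg
bracket. -/
theorem bosonBracket_self (hp : p.Admissible) (i : Fin 2) {n : ℕ} (hn : n ≠ 0) :
    bosonBracket p i i n = n := by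
  have h := hp.heis_self_ne_zero i (n := n) (by exact_mod_cast hn)
  rw [Params.heis, if_pos rfl, Int.natAbs_natCast, inv_pow] at h
  rw [bosonBracket, Params.heis, if_pos rfl, Int.natAbs_natCast, inv_pow,
    mul_div_cancel_right₀ _ (right_ne_zero_of_mul h)]
  rfl

theorem bosonBracket_of_ne {i j : Fin 2} (hij : i ≠ j) (n : ℕ) :
    bosonBracket p i j n = -(n * ((p.q₁ ^ n + p.q₃ ^ n) / (1 + (p.q₂ ^ n)⁻¹))) := by
  rw [bosonBracket, Params.heis, if_neg hij, Int.natAbs_natCast, neg_div, mul_div_assoc]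
  rfl

/-- `- n` times the contraction of `:Λ^s_1(ξ z) Λ^t_2(z):` with `:Λ^s'_1(ξ z) Λ^t'_2(z):` at mode
`n`, as a function of `Q = q ^ n`, `κ = (q₁ ^ n + q₃ ^ n) / (1 + q₂ ^ (-n))` and `x = ξ ^ n`. -/
def contractionSum (Q κ x : ℂ) (s t s' t' : ℤ) : ℂ :=
  s * s' * Q ^ (s - s') + t * t' * Q ^ (t - t') -
    κ * (s * t' * Q ^ (s - t') * x⁻¹ + t * s' * Q ^ (t - s') * x)

/-- Exchanging the colours is the same as inverting ξ. This reduces the case ξ = a⁻¹ to ξ = a. -/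
theorem contractionSum_swap (Q κ x : ℂ) (s t s' t' : ℤ) :
    contractionSum Q κ x⁻¹ t s t' s' = contractionSum Q κ x s t s' t' := by
  unfold contractionSum
  rw [inv_inv]
  ring

theorem contraction_pairField (hp : p.Admissible) (L : ℂ) (s t s' t' : ℤ) {n : ℕ} (hn : n ≠ 0) :
    (pairField p L s t).contraction p (pairField p L s' t') n =
      -(contractionSum (p.q ^ n) ((p.q₁ ^ n + p.q₃ ^ n) / (1 + (p.q₂ ^ n)⁻¹))
        (Complex.exp L ^ n) s t s' t' / n) := by
  have hq := hp.q_ne_zero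
  have hQ := pow_ne_zero n hq
  have hn' : (n : ℂ) ≠ 0 := by exact_mod_cast hn
  have hx := pow_ne_zero n (Complex.exp_ne_zero L)
  have e1 : ∀ s : ℤ, p.q ^ (s * (n : ℤ)) = (p.q ^ n) ^ s := by
    intro s; rw [mul_comm, zpow_mul, zpow_natCast]
  have e2 : ∀ s : ℤ, p.q ^ (s * -(n : ℤ)) = ((p.q ^ n) ^ s)⁻¹ := by
    intro s; rw [mul_neg, zpow_neg, e1]
  simp only [LinField.contraction, Fin.sum_univ_two, pairField_osc_zero, pairField_osc_one,
    bosonBracket_self hp _ hn, bosonBracket_of_ne (zero_ne_one (α := Fin 2)),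
    bosonBracket_of_ne (one_ne_zero (α := Fin 2)), e1, e2, contractionSum, zpow_sub₀ hQ, neg_neg,
    zpow_neg, zpow_natCast, Int.cast_neg, Int.cast_natCast]
  generalize (p.q₁ ^ n + p.q₃ ^ n) / (1 + (p.q₂ ^ n)⁻¹) = κ
  generalize Complex.exp L ^ n = x at *
  have hs := zpow_ne_zero s hQ
  have ht := zpow_ne_zero t hQ
  have hs' := zpow_ne_zero s' hQ
  have ht' := zpow_ne_zero t' hQ
  generalize (p.q ^ n) ^ s = S at *
  generalize (p.q ^ n) ^ t = T at *
  generalize (p.q ^ n) ^ s' = S' at *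
  generalize (p.q ^ n) ^ t' = T' at *
  field_simp
  ring

/-! ## Structure series times contractions -/

section ContractionSum

variable {A B Q : ℂ}

theorem zpow_two_of_sq_mul (h : Q ^ 2 * (A * B) = 1) :
    Q ^ (2 : ℤ) = (A * B)⁻¹ ∧ Q ^ (-2 : ℤ) = A * B := by
  have h1 : Q ^ (2 : ℤ) = (A * B)⁻¹ := by
    rw [show Q ^ (2 : ℤ) = Q ^ 2 from by norm_cast]
    exact eq_inv_of_mul_eq_one_left h
  exact ⟨h1, by rw [zpow_neg, h1, inv_inv]⟩

/-- Here and below A = aⁿ, B = bⁿ, Q = qⁿ, and the left side is n times the exponent of g·S. After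
the denominator 1 + A B cancels, what remains is a signed sum of n-th powers, so g·S is rational. In
the present case g exactly inverts S. -/
theorem contractionSum_same (hA : A ≠ 0) (hAB : 1 + A * B ≠ 0) {s : ℤ} (hs : s = 1 ∨ s = -1) :
    (1 - A ^ 2) * (1 - B / A) / (1 + A * B) -
      contractionSum Q ((A + B) / (1 + A * B)) A s s s s = 0 := by
  rcases hs with rfl | rfl <;>
  · simp only [contractionSum, sub_self, zpow_zero, Int.cast_one, Int.cast_neg]
    field_simp
    ring

theorem contractionSum_plus_minus (hA : A ≠ 0) (hB : B ≠ 0) (hAB : 1 + A * B ≠ 0)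
    (hQ : Q ^ 2 * (A * B) = 1) :
    (1 - A ^ 2) * (1 - B / A) / (1 + A * B) -
      contractionSum Q ((A + B) / (1 + A * B)) A 1 1 (-1) (-1) =
        1 + (A * B)⁻¹ - A / B - (A ^ 2)⁻¹ := by
  simp only [contractionSum, show (1 : ℤ) - -1 = 2 from rfl, (zpow_two_of_sq_mul hQ).1,
    Int.cast_one, Int.cast_neg]
  field_simp
  ring

theorem contractionSum_minus_plus (hA : A ≠ 0) (hAB : 1 + A * B ≠ 0)
    (hQ : Q ^ 2 * (A * B) = 1) :
    (1 - A ^ 2) * (1 - B / A) / (1 + A * B) -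
      contractionSum Q ((A + B) / (1 + A * B)) A (-1) (-1) 1 1 =
        1 + A * B - B / A - A ^ 2 := by
  simp only [contractionSum, show (-1 : ℤ) - 1 = -2 from rfl, (zpow_two_of_sq_mul hQ).2,
    Int.cast_one, Int.cast_neg]
  field_simp
  ring

theorem contractionSum_same_left (hA : A ≠ 0) (hB : B ≠ 0) (hAB : 1 + A * B ≠ 0)
    (hQ : Q ^ 2 * (A * B) = 1) :
    (1 - A ^ 2) * (1 - B / A) / (1 + A * B) -
      contractionSum Q ((A + B) / (1 + A * B)) A 1 1 1 (-1) = 1 - (A ^ 2)⁻¹ ∧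
    (1 - A ^ 2) * (1 - B / A) / (1 + A * B) -
      contractionSum Q ((A + B) / (1 + A * B)) A (-1) (-1) 1 (-1) = 1 - A ^ 2 := by
  constructor <;>
  · simp only [contractionSum, show (1 : ℤ) - -1 = 2 from rfl, show (-1 : ℤ) - 1 = -2 from rfl,
      sub_self, zpow_zero, (zpow_two_of_sq_mul hQ).1, (zpow_two_of_sq_mul hQ).2, Int.cast_one,
      Int.cast_neg]
    field_simp
    ring

theorem contractionSum_same_right (hA : A ≠ 0) (hB : B ≠ 0) (hAB : 1 + A * B ≠ 0)
    (hQ : Q ^ 2 * (A * B) = 1) :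
    (1 - A ^ 2) * (1 - B / A) / (1 + A * B) -
      contractionSum Q ((A + B) / (1 + A * B)) A 1 (-1) 1 1 = 1 - A ^ 2 ∧
    (1 - A ^ 2) * (1 - B / A) / (1 + A * B) -
      contractionSum Q ((A + B) / (1 + A * B)) A 1 (-1) (-1) (-1) = 1 - (A ^ 2)⁻¹ := by
  constructor <;>
  · simp only [contractionSum, show (1 : ℤ) - -1 = 2 from rfl, show (-1 : ℤ) - 1 = -2 from rfl,
      sub_self, zpow_zero, (zpow_two_of_sq_mul hQ).1, (zpow_two_of_sq_mul hQ).2, Int.cast_one,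
      Int.cast_neg]
    field_simp
    ring

theorem contractionSum_mixed (hA : A ≠ 0) (hB : B ≠ 0) (hAB : 1 + A * B ≠ 0)
    (hQ : Q ^ 2 * (A * B) = 1) :
    (1 - A ^ 2) * (1 - B / A) / (1 + A * B) -
      contractionSum Q ((A + B) / (1 + A * B)) A 1 (-1) 1 (-1) =
        -(A ^ 2 + (A ^ 2)⁻¹ + A * B + (A * B)⁻¹) := by
  simp only [contractionSum, show (1 : ℤ) - -1 = 2 from rfl, show (-1 : ℤ) - 1 = -2 from rfl,
    sub_self, zpow_zero, (zpow_two_of_sq_mul hQ).1, (zpow_two_of_sq_mul hQ).2, Int.cast_one,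
    Int.cast_neg]
  field_simp
  ring

end ContractionSum

/-- The pair `(a, b)` is `(q₁, q₃)` or `(q₃, q₁)`. -/
def IsPair (p : Params) (a b : ℂ) : Prop := (a = p.q₁ ∧ b = p.q₃) ∨ (a = p.q₃ ∧ b = p.q₁)

namespace IsPair

variable {a b : ℂ}

theorem ne_zero_left (hab : IsPair p a b) (hp : p.Admissible) : a ≠ 0 := by
  rcases hab with ⟨rfl, _⟩ | ⟨rfl, _⟩
  exacts [hp.q₁_ne_zero, hp.q₃_ne_zero]

theorem ne_zero_right (hab : IsPair p a b) (hp : p.Admissible) : b ≠ 0 := by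
  rcases hab with ⟨_, rfl⟩ | ⟨_, rfl⟩
  exacts [hp.q₃_ne_zero, hp.q₁_ne_zero]

theorem sq_mul (hab : IsPair p a b) (hp : p.Admissible) : p.q ^ 2 * (a * b) = 1 := by
  rcases hab with ⟨rfl, rfl⟩ | ⟨rfl, rfl⟩
  · exact hp.q_sq_mul
  · rw [mul_comm p.q₃, hp.q_sq_mul]

theorem pow_sq_mul (hab : IsPair p a b) (hp : p.Admissible) (n : ℕ) :
    (p.q ^ n) ^ 2 * (a ^ n * b ^ n) = 1 := by
  rw [← pow_mul, mul_comm n, pow_mul, ← mul_pow, ← mul_pow, hab.sq_mul hp, one_pow]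

theorem inv_q₂_pow (hab : IsPair p a b) (hp : p.Admissible) (n : ℕ) :
    (p.q₂ ^ n)⁻¹ = a ^ n * b ^ n := by
  have h := hab.pow_sq_mul hp n
  rw [Params.q₂, ← pow_mul, mul_comm 2, pow_mul]
  exact inv_eq_of_mul_eq_one_right h

theorem one_add_ne_zero (hab : IsPair p a b) (hp : p.Admissible) {n : ℕ} (hn : n ≠ 0) :
    1 + a ^ n * b ^ n ≠ 0 := by
  intro h
  have h1 := hab.pow_sq_mul hp n
  refine hp.one_add_q_pow_ne_zero hn ?_
  linear_combination (p.q ^ n) ^ 2 * h - h1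

theorem add_pow (hab : IsPair p a b) (n : ℕ) : p.q₁ ^ n + p.q₃ ^ n = a ^ n + b ^ n := by
  rcases hab with ⟨rfl, rfl⟩ | ⟨rfl, rfl⟩
  · rfl
  · rw [add_comm]

end IsPair

/-- The vertex operator `X(z)` has the exponent of `:Λ^x_1(ξ z) Λ^y_2(z):` if `s = 1`, and that of
`:Λ^y_1(ξ z) Λ^x_2(z):` if `s = -1`. -/
def Oriented (p : Params) (L : ℂ) (s : ℤ) (X : VertexData) (x y : ℤ) : Prop :=
  (s = 1 ∧ X.field = pairField p L x y) ∨ (s = -1 ∧ X.field = pairField p L y x)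

/-- Exponents add, so a product of g with S is known once the combined exponent T n / n is. For s =
-1 both operators have their colours exchanged and ξ = a⁻¹, which leaves the contraction unchanged.
-/
theorem structureSeries_mul_opeSeries (hp : p.Admissible) {a b : ℂ} (hab : IsPair p a b) {L : ℂ}
    {s : ℤ} (hξ : Complex.exp L ^ s = a) {X Y : VertexData} {x y x' y' : ℤ}
    (hX : Oriented p L s X x y) (hY : Oriented p L s Y x' y') (T : ℕ → ℂ)
    (hT : ∀ n, n ≠ 0 → (1 - (a ^ n) ^ 2) * (1 - b ^ n / a ^ n) / (1 + a ^ n * b ^ n) -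
      contractionSum (p.q ^ n) ((a ^ n + b ^ n) / (1 + a ^ n * b ^ n)) (a ^ n) x y x' y' = T n) :
    structureSeries p a b * VertexData.opeSeries p X Y = expSeries fun n => T n / n := by
  rw [structureSeries, VertexData.opeSeries, ← expSeries_add_complex]
  refine expSeries_congr fun n hn => ?_
  have hc : X.field.contraction p Y.field n =
      -(contractionSum (p.q ^ n) ((a ^ n + b ^ n) / (1 + a ^ n * b ^ n)) (a ^ n) x y x' y' / n) := by
    rcases hX with ⟨rfl, hX⟩ | ⟨rfl, hX⟩
    · rcases hY with ⟨_, hY⟩ | ⟨h, _⟩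
      · rw [hX, hY, contraction_pairField hp _ _ _ _ _ hn, hab.add_pow, hab.inv_q₂_pow hp]
        rw [zpow_one] at hξ
        rw [hξ]
      · exact absurd h (by norm_num)
    · rcases hY with ⟨h, _⟩ | ⟨_, hY⟩
      · exact absurd h (by norm_num)
      · rw [hX, hY, contraction_pairField hp _ _ _ _ _ hn, hab.add_pow, hab.inv_q₂_pow hp]
        rw [zpow_neg_one] at hξ
        rw [← contractionSum_swap, ← hξ, inv_pow]
  rw [Pi.add_apply, hc, ← hT n hn, hab.inv_q₂_pow hp, mul_comm 2 n, pow_mul]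
  have h1 := hab.one_add_ne_zero hp hn
  have h2 : (n : ℂ) ≠ 0 := by exact_mod_cast hn
  field_simp
  ring

/-! ## Delta functions -/

/-- Both terms expand the rational function (u⁻¹ - x)/(1 - x), one at x = 0 and the other at x = ∞.
The difference is a multiple of δ(x), so its coefficients do not depend on j. -/
theorem one_pole_delta {u : ℂ} (hu : u ≠ 0) (j : ℤ) :
    u⁻¹ * zcoeff (expSeries fun n => (1 - u ^ n) / n) j -
      zcoeff (expSeries fun n => (1 - u⁻¹ ^ n) / n) (-j) = u⁻¹ - 1 := by
  rw [zcoeff_expSeries_one_pole, zcoeff_expSeries_one_pole]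
  rcases lt_trichotomy j 0 with h | rfl | h
  · rw [if_neg (by omega), if_neg (by omega), if_pos (by omega)]
    ring
  · simp
  · rw [if_pos h, if_neg (by omega), if_neg (by omega)]
    field_simp
    ring

/-- For c = u v the function (1 - u x)(1 - v x)/((1 - x)(1 - c x)) is unchanged when u, v, c and x
are all inverted. The two terms are therefore its expansions at 0 and ∞, and the poles x = 1 and x =
c⁻¹ produce multiples of δ(x) and δ(c x). -/
theorem two_poles_delta {u v c : ℂ} (hu : u ≠ 0) (hv : v ≠ 0) (hc : c = u * v) (hc1 : c ≠ 1)
    (j : ℤ) :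
    zcoeff (expSeries fun n => (1 + c ^ n - u ^ n - v ^ n) / n) j -
      zcoeff (expSeries fun n => (1 + c⁻¹ ^ n - u⁻¹ ^ n - v⁻¹ ^ n) / n) (-j) =
        (1 - u) * (1 - v) / (1 - c) + -((1 - u) * (1 - v) / (1 - c)) * c ^ j := by
  have hc0 : c ≠ 0 := hc ▸ mul_ne_zero hu hv
  have h1 : 1 - c ≠ 0 := sub_ne_zero.mpr hc1.symm
  have h2 : c - 1 ≠ 0 := sub_ne_zero.mpr hc1
  have hα : (1 - u⁻¹) * (1 - v⁻¹) / (1 - c⁻¹) = -((1 - u) * (1 - v) / (1 - c)) := by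
    have h3 : (1 - u⁻¹) * (1 - v⁻¹) = (1 - u) * (1 - v) * c⁻¹ := by
      rw [hc]
      field_simp
      ring
    have h4 : 1 - c⁻¹ = -(1 - c) * c⁻¹ := by
      field_simp
      ring
    rw [h3, h4, mul_div_mul_right _ _ (inv_ne_zero hc0), div_neg]
  rw [zcoeff_expSeries_two_poles hc hc1,
    zcoeff_expSeries_two_poles (by rw [hc, mul_inv]) (inv_eq_one.not.mpr hc1), hα, inv_zpow',
    neg_neg]
  rcases lt_trichotomy j 0 with h | rfl | h
  · rw [if_neg (by omega), if_neg (by omega), if_pos (by omega)]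
    ring
  · simp
  · rw [if_pos h, if_neg (by omega), if_neg (by omega)]
    ring

/-- The two vertex operators without translation of sectors are inverse to each other at
`z = q₂⁻¹ w`. -/
theorem finsum_normalPair_inverse (hp : p.Admissible) (L : ℂ) (k l : ℤ) (n : ℤ × ℤ) {f : Osc}
    {N : ℕ} (hf : f ∈ oscFilt N) :
    ∑ᶠ j : ℤ, p.q₂ ^ j • VertexData.normalPair p (pairVertex p L 1 1 0 p.q 0)
      (pairVertex p L (-1) (-1) 0 p.q⁻¹ 0) n f N (k + j) (l - j) =
        if k + l = 0 then p.q₂ ^ (-k) • Finsupp.single n f else 0 := by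
  have hq := hp.q_ne_zero
  have hq₂ : p.q₂ ≠ 0 := pow_ne_zero 2 hq
  -- The prefactors q and q⁻¹ and the zero-mode exponentials of the two operators are mutually
  -- inverse, so only the oscillators remain.
  have hpair : ∀ j : ℤ, VertexData.normalPair p (pairVertex p L 1 1 0 p.q 0)
      (pairVertex p L (-1) (-1) 0 p.q⁻¹ 0) n f N (k + j) (l - j) =
      Finsupp.single n (LinField.normalProd p (pairField p L 1 1) (pairField p L (-1) (-1)) N
        (k + j) (l - j) f) := by
    intro j
    unfold VertexData.normalPair pairVertex
    simp only [zero_mul, mul_zero, neg_zero, add_zero, sub_zero, Prod.mk_zero_zero]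
    rw [mul_mul_mul_comm, mul_inv_cancel₀ hq, ← Complex.exp_add, one_mul]
    have : ((1 : ℤ) * L * (n.1 - n.2) / 2 + ((1 : ℤ) + (1 : ℤ)) * p.logq₁ * zetaZero p +
        ((-1 : ℤ) * L * (n.1 - n.2) / 2 + ((-1 : ℤ) + (-1 : ℤ)) * p.logq₁ * zetaZero p) : ℂ) =
        0 := by
      push_cast
      ring
    rw [this, Complex.exp_zero, one_smul]
  have hcre : ∀ (i : Fin 2) (m : ℕ), m ≠ 0 → p.q₂ ^ m * (pairField p L 1 1).osc i (-(m : ℤ)) +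
      (pairField p L (-1) (-1)).osc i (-(m : ℤ)) = 0 := by
    intro i m hm
    have hm' : (m : ℂ) ≠ 0 := by exact_mod_cast hm
    have h2 : p.q₂ ^ m = p.q ^ m * p.q ^ m := by
      rw [Params.q₂, ← mul_pow, sq]
    fin_cases i <;>
    · simp only [Fin.zero_eta, Fin.mk_one, pairField_osc_zero, pairField_osc_one, one_mul,
        neg_one_mul, neg_neg, zpow_neg, zpow_natCast, h2, Int.cast_one, Int.cast_neg,
        Int.cast_natCast]
      field_simp
      ring
  have hann : ∀ (i : Fin 2) (m : ℕ), m ≠ 0 → p.q₂⁻¹ ^ m * (pairField p L 1 1).osc i (m : ℤ) +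
      (pairField p L (-1) (-1)).osc i (m : ℤ) = 0 := by
    intro i m hm
    have hm' : (m : ℂ) ≠ 0 := by exact_mod_cast hm
    have h2 : p.q₂⁻¹ ^ m = (p.q ^ m)⁻¹ * (p.q ^ m)⁻¹ := by
      rw [Params.q₂, inv_pow, ← mul_inv, ← mul_pow, sq]
    fin_cases i <;>
    · simp only [Fin.zero_eta, Fin.mk_one, pairField_osc_zero, pairField_osc_one, one_mul,
        neg_one_mul, zpow_neg, zpow_natCast, h2, Int.cast_one, Int.cast_neg,
        Int.cast_natCast]
      field_simp
      ring
  have hsupp : ∀ j : ℤ, -N < k + j → -N < l - j → j ∈ Finset.Icc (-N - k) (l + N) := by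
    intro j h1 h2
    rw [Finset.mem_Icc]
    omega
  have hsum := LinField.sum_zpow_smul_normalProd (p := p) _ _ hq₂ hcre hann k l hf _ hsupp
  rw [finsum_eq_sum_of_support_subset (s := Finset.Icc (-N - k) (l + N))]
  · simp only [hpair]
    have : ∀ j : ℤ, p.q₂ ^ j • Finsupp.single n (LinField.normalProd p (pairField p L 1 1)
        (pairField p L (-1) (-1)) N (k + j) (l - j) f) = Finsupp.lsingle (R := ℂ) n
        (p.q₂ ^ j • LinField.normalProd p (pairField p L 1 1)
          (pairField p L (-1) (-1)) N (k + j) (l - j) f) := fun j => by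
      rw [map_smul, Finsupp.lsingle_apply]
    simp only [this]
    rw [← map_sum, hsum]
    split_ifs
    · rw [map_smul, Finsupp.lsingle_apply]
    · exact map_zero _
  · intro j hj
    by_contra hc
    refine hj ?_
    simp only [hpair]
    rcases le_or_gt (k + j) (-N) with h | h
    · rw [LinField.normalProd_eq_zero_left _ _ _ h]
      simp
    · rw [LinField.normalProd_eq_zero_right _ _ _ (not_lt.mp fun h' => hc (hsupp j h h'))]
      simp

/-! ## The quadratic relation -/

/-- The nine defects are evaluated pair by pair. The coefficient c₃ is arbitrary, since every
contribution of the third operator cancels; the right-hand side comes from the first two alone. -/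
theorem quadraticRelation_of_pair (hp : p.Admissible) {a b : ℂ} (hab : IsPair p a b) {L : ℂ}
    {s : ℤ} (hs : s = 1 ∨ s = -1) (hξ : Complex.exp L ^ s = a) (c₃ : ℂ)
    (hT : ∀ m, TMode p L m = (pairVertex p L 1 1 0 p.q 0).mode p (-m) +
      (pairVertex p L (-1) (-1) 0 p.q⁻¹ 0).mode p (-m) +
      (pairVertex p L s (-s) s c₃ 2).mode p (-m)) :
    QuadraticRelation (TMode p L) (structureSeries p a b) (structureConst p a b) p.q₂ := by
  set X : Fin 3 → VertexData := fun i => pairVertex p L (![1, -1, s] i) (![1, -1, -s] i)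
    (![0, 0, s] i) (![p.q, p.q⁻¹, c₃] i) (![0, 0, 2] i) with hXdef
  have hX0 : X 0 = pairVertex p L 1 1 0 p.q 0 := rfl
  have hX1 : X 1 = pairVertex p L (-1) (-1) 0 p.q⁻¹ 0 := rfl
  have hX2 : X 2 = pairVertex p L s (-s) s c₃ 2 := rfl
  have hTX : TMode p L = fun m => ∑ i, (X i).mode p (-m) := by
    funext m
    rw [hT, Fin.sum_univ_three, hX0, hX1, hX2]
  rw [hTX]
  refine quadraticRelation_sum hp X (fun i j => Complex.exp L ^ (2 * (![1, -1, s] i) * ![0, 0, s] j))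
    (fun i j => 4 * ![0, 0, s] i * ![0, 0, s] j) (fun i j => pairVertex_twist p _ _ _ _ _ _ _ _ _ _ _)
    ?_
  intro k l n f
  obtain ⟨N, hf⟩ := exists_mem_oscFilt f
  have ha := hab.ne_zero_left hp
  have hb := hab.ne_zero_right hp
  simp only [Fin.sum_univ_three, hX0, hX1, hX2]
  set A := pairVertex p L 1 1 0 p.q 0 with hA
  set B := pairVertex p L (-1) (-1) 0 p.q⁻¹ 0 with hB
  set C := pairVertex p L s (-s) s c₃ 2 with hC
  have oA : Oriented p L s A 1 1 := hs.imp (fun h => ⟨h, rfl⟩) fun h => ⟨h, rfl⟩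
  have oB : Oriented p L s B (-1) (-1) := hs.imp (fun h => ⟨h, rfl⟩) fun h => ⟨h, rfl⟩
  have oC : Oriented p L s C 1 (-1) :=
    hs.imp (fun h => ⟨h, by rw [hC, h]; rfl⟩) fun h => ⟨h, by rw [hC, h]; rfl⟩
  have tAA : A.Twist A 1 0 := by simpa using pairVertex_twist p L 1 1 0 p.q 0 1 1 0 p.q 0
  have tBB : B.Twist B 1 0 := by
    simpa using pairVertex_twist p L (-1) (-1) 0 p.q⁻¹ 0 (-1) (-1) 0 p.q⁻¹ 0
  have tAB : A.Twist B 1 0 := by simpa using pairVertex_twist p L 1 1 0 p.q 0 (-1) (-1) 0 p.q⁻¹ 0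
  have tBA : B.Twist A 1 0 := by simpa using pairVertex_twist p L (-1) (-1) 0 p.q⁻¹ 0 1 1 0 p.q 0
  have tCA : C.Twist A 1 0 := by simpa using pairVertex_twist p L s (-s) s c₃ 2 1 1 0 p.q 0
  have tCB : C.Twist B 1 0 := by
    simpa using pairVertex_twist p L s (-s) s c₃ 2 (-1) (-1) 0 p.q⁻¹ 0
  -- The factor is ξ^{2s} = a². It is what turns the two orders of A and C into expansions of one
  -- rational function.
  have tAC : A.Twist C (a ^ 2) 0 := by
    have := pairVertex_twist p L 1 1 0 p.q 0 s (-s) s c₃ 2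
    rwa [mul_zero, zero_mul, mul_one, mul_comm 2 s, zpow_mul, hξ,
      show a ^ (2 : ℤ) = a ^ 2 from by norm_cast] at this
  have tBC : B.Twist C (a ^ 2)⁻¹ 0 := by
    have := pairVertex_twist p L (-1) (-1) 0 p.q⁻¹ 0 s (-s) s c₃ 2
    rwa [mul_zero, zero_mul, mul_comm _ s, zpow_mul, hξ, show (2 : ℤ) * -1 = -2 from rfl, zpow_neg,
      show a ^ (2 : ℤ) = a ^ 2 from by norm_cast] at this
  have tCC : C.Twist C (Complex.exp L ^ (2 * s * s)) 4 := by
    have := pairVertex_twist p L s (-s) s c₃ 2 s (-s) s c₃ 2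
    rwa [show 4 * s * s = 4 by rcases hs with rfl | rfl <;> rfl] at this
  have hAn := fun n : ℕ => pow_ne_zero n ha
  have hBn := fun n : ℕ => pow_ne_zero n hb
  have hne := fun (n : ℕ) (hn : n ≠ 0) => hab.one_add_ne_zero hp hn
  have hQ := hab.pow_sq_mul hp
  have gAA := structureSeries_mul_opeSeries hp hab hξ oA oA (fun _ => 0)
    fun n hn => contractionSum_same (hAn n) (hne n hn) (Or.inl rfl)
  have gBB := structureSeries_mul_opeSeries hp hab hξ oB oB (fun _ => 0)
    fun n hn => contractionSum_same (hAn n) (hne n hn) (Or.inr rfl)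
  have gAB := structureSeries_mul_opeSeries hp hab hξ oA oB
    (fun n => 1 + ((a * b)⁻¹) ^ n - (a / b) ^ n - ((a ^ 2)⁻¹) ^ n)
    fun n hn => (contractionSum_plus_minus (hAn n) (hBn n) (hne n hn) (hQ n)).trans
      (by rw [inv_pow, mul_pow, div_pow, inv_pow, pow_right_comm])
  have gBA := structureSeries_mul_opeSeries hp hab hξ oB oA
    (fun n => 1 + ((a * b)⁻¹)⁻¹ ^ n - (a / b)⁻¹ ^ n - ((a ^ 2)⁻¹)⁻¹ ^ n)
    fun n hn => (contractionSum_minus_plus (hAn n) (hne n hn) (hQ n)).trans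
      (by rw [inv_inv, inv_div, inv_inv, mul_pow, div_pow, pow_right_comm])
  have gAC := structureSeries_mul_opeSeries hp hab hξ oA oC (fun n => 1 - ((a ^ 2)⁻¹) ^ n)
    fun n hn => (contractionSum_same_left (hAn n) (hBn n) (hne n hn) (hQ n)).1.trans
      (by rw [inv_pow, pow_right_comm])
  have gBC := structureSeries_mul_opeSeries hp hab hξ oB oC (fun n => 1 - (a ^ 2) ^ n)
    fun n hn => (contractionSum_same_left (hAn n) (hBn n) (hne n hn) (hQ n)).2.trans
      (by rw [pow_right_comm])
  have gCA := structureSeries_mul_opeSeries hp hab hξ oC oA (fun n => 1 - ((a ^ 2)⁻¹)⁻¹ ^ n)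
    fun n hn => (contractionSum_same_right (hAn n) (hBn n) (hne n hn) (hQ n)).1.trans
      (by rw [inv_inv, pow_right_comm])
  have gCB := structureSeries_mul_opeSeries hp hab hξ oC oB (fun n => 1 - (a ^ 2)⁻¹ ^ n)
    fun n hn => (contractionSum_same_right (hAn n) (hBn n) (hne n hn) (hQ n)).2.trans
      (by rw [inv_pow, pow_right_comm])
  have gCC := structureSeries_mul_opeSeries hp hab hξ oC oC
    (fun n => -((a ^ 2) ^ n + (a ^ 2)⁻¹ ^ n + (a * b) ^ n + (a * b)⁻¹ ^ n))
    fun n hn => (contractionSum_mixed (hAn n) (hBn n) (hne n hn) (hQ n)).trans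
      (by rw [inv_pow, inv_pow, mul_pow, pow_right_comm])
  have hone : expSeries (fun n : ℕ => (0 : ℂ) / (n : ℂ)) = 1 := by
    rw [← expSeries_zero]
    exact expSeries_congr fun n _ => zero_div _
  have hab1 : (a * b)⁻¹ ≠ 1 := by
    intro h
    have h1 := hab.sq_mul hp
    rw [inv_eq_one.mp h, mul_one] at h1
    exact hp.q_pow_ne_one two_ne_zero h1
  have hq₂ : p.q₂ = (a * b)⁻¹ := eq_inv_of_mul_eq_one_left (hab.sq_mul hp)
  have sAA : VertexData.defect p (structureSeries p a b) A A k l (Finsupp.single n f) = 0 := by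
    refine VertexData.defect_self hp tAA _ (fun j => ?_) k l n f
    rw [gAA, hone, zcoeff_one, zcoeff_one]
    simp
  have sBB : VertexData.defect p (structureSeries p a b) B B k l (Finsupp.single n f) = 0 := by
    refine VertexData.defect_self hp tBB _ (fun j => ?_) k l n f
    rw [gBB, hone, zcoeff_one, zcoeff_one]
    simp
  have sCC : VertexData.defect p (structureSeries p a b) C C k l (Finsupp.single n f) = 0 := by
    refine VertexData.defect_self hp tCC _ (fun j => ?_) k l n f
    rw [gCC]
    exact zcoeff_expSeries_palindromic (pow_ne_zero 2 ha) (mul_ne_zero ha hb) j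
  -- The only pole is x = 1, so β = 0 and the value c = 1 plays no role.
  have sAC := VertexData.defect_add_defect hp tAC tCA (structureSeries p a b) (a ^ 2 - 1) 0 1
    (fun j => by
      rw [gAC, gCA, one_mul, zero_mul, add_zero]
      have := one_pole_delta (inv_ne_zero (pow_ne_zero 2 ha)) j
      rwa [inv_inv] at this ⊢) k l n hf
  have sBC := VertexData.defect_add_defect hp tBC tCB (structureSeries p a b) ((a ^ 2)⁻¹ - 1) 0 1
    (fun j => by
      rw [gBC, gCB, one_mul, zero_mul, add_zero]
      exact one_pole_delta (pow_ne_zero 2 ha) j) k l n hf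
  -- Here u = a/b and v = a⁻², so the second pole is governed by u v = (a b)⁻¹ = q₂.
  have sAB := VertexData.defect_add_defect hp tAB tBA (structureSeries p a b) _ _ _
    (fun j => by
      rw [gAB, gBA, one_mul, one_mul]
      exact two_poles_delta (div_ne_zero ha hb) (inv_ne_zero (pow_ne_zero 2 ha))
        (by field_simp) hab1 j) k l n hf
  rw [← hq₂, finsum_normalPair_inverse hp L k l n hf, finsum_normalPair_inverse hp L l k n hf]
    at sAB
  rw [zero_smul, zero_smul, sub_zero] at sAC sBC
  have hconst : -((1 - a / b) * (1 - (a ^ 2)⁻¹) / (1 - p.q₂)) = -structureConst p a b := by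
    rw [structureConst, hq₂, inv_inv]
    have h1 : 1 - (a * b)⁻¹ ≠ 0 := sub_ne_zero.mpr hab1.symm
    have h2 : 1 - a * b ≠ 0 := sub_ne_zero.mpr fun h => hab1 (by rw [← h, inv_one])
    have h3 : 1 - (a * b)⁻¹ = -(1 - a * b) * (a * b)⁻¹ := by
      field_simp
      ring
    rw [h3]
    field_simp
    ring
  rw [hconst] at sAB
  -- The six mixed defects are grouped into the pairs AB + BA, AC + CA and BC + CB.
  rw [sAA, sBB, sCC, show ∀ u v w x y z : Fock, 0 + u + v + (w + 0 + x) + (y + z + 0) =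
    (u + w) + ((v + y) + (x + z)) by intros; abel, sAB, sAC, sBC, add_zero, add_zero]
  unfold deltaCoeff
  by_cases hkl : k + l = 0
  · have hl : l = -k := by omega
    subst hl
    rw [if_pos (by omega), if_pos (by omega), if_pos (by omega), if_pos (by omega), neg_neg,
      inv_zpow', neg_neg]
    module
  · rw [if_neg hkl, if_neg (by omega), if_neg (by omega), if_neg (by omega)]
    simp

theorem TMode_eq_mode (L : ℂ) (m : ℤ) : TMode p L m =
    (pairVertex p L 1 1 0 p.q 0).mode p (-m) + (pairVertex p L (-1) (-1) 0 p.q⁻¹ 0).mode p (-m) +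
      M₃ p L 0 1 (-m - 2) + M₄ p L 0 1 (-m - 2) := by
  rw [← smul_normalExp_eq_mode p L (by norm_num) p.q 0 (-m) (r := -m) (by push_cast; ring),
    ← smul_normalExp_eq_mode p L (by norm_num) p.q⁻¹ 0 (-m) (r := -m) (by push_cast; ring)]
  unfold TMode TCoeff M₁ M₂
  rw [lambdaPlus_eq, lambdaPlus_eq, lambdaMinus_eq, lambdaMinus_eq]
  rfl

theorem M₃_eq_mode (L : ℂ) (m : ℤ) : M₃ p L 0 1 (-m - 2) =
    (pairVertex p L 1 (-1) 1 (p.q * (1 - p.q₁ * Complex.exp L) * (1 - p.q₃ * Complex.exp L))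
      2).mode p (-m) := by
  rw [← smul_normalExp_eq_mode p L (by norm_num) _ 2 (-m) (r := -m - 2) (by push_cast; ring), M₃,
    lambdaPlus_eq, lambdaMinus_eq]
  rfl

theorem M₄_eq_mode (L : ℂ) (m : ℤ) : M₄ p L 0 1 (-m - 2) =
    (pairVertex p L (-1) 1 (-1) (p.q⁻¹ * (1 - p.q₁⁻¹ * Complex.exp L) *
      (1 - p.q₃⁻¹ * Complex.exp L)) 2).mode p (-m) := by
  rw [← smul_normalExp_eq_mode p L (by norm_num) _ 2 (-m) (r := -m - 2) (by push_cast; ring), M₄,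
    lambdaPlus_eq, lambdaMinus_eq]
  rfl

/-! ### Vanishing of one mixed term at the special values of ξ. -/

theorem M₃_eq_zero (hp : p.Admissible) {L : ℂ}
    (hL : Complex.exp L = p.q₁⁻¹ ∨ Complex.exp L = p.q₃⁻¹) (i j : Fin 2) (e : ℚ) :
    M₃ p L i j e = 0 := by
  have h1 := hp.q₁_ne_zero
  have h3 := hp.q₃_ne_zero
  rcases hL with hL | hL <;> simp [M₃, hL, h1, h3]

theorem M₄_eq_zero (hp : p.Admissible) {L : ℂ}
    (hL : Complex.exp L = p.q₁ ∨ Complex.exp L = p.q₃) (i j : Fin 2) (e : ℚ) :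
    M₄ p L i j e = 0 := by
  have h1 := hp.q₁_ne_zero
  have h3 := hp.q₃_ne_zero
  rcases hL with hL | hL <;> simp [M₄, hL, h1, h3]

/-- At ξ = a the term M₄ vanishes and the orientation is s = 1. At ξ = a⁻¹ the term M₃ vanishes and
s = -1. -/
theorem quadraticRelation_TMode (hp : p.Admissible) {a b : ℂ} (hab : IsPair p a b) {L : ℂ}
    (hL : Complex.exp L = a ∨ Complex.exp L = a⁻¹) :
    QuadraticRelation (TMode p L) (structureSeries p a b) (structureConst p a b) p.q₂ := by
  rcases hL with hL | hL
  · refine quadraticRelation_of_pair hp hab (Or.inl rfl) (by rw [zpow_one, hL])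
      (p.q * (1 - p.q₁ * Complex.exp L) * (1 - p.q₃ * Complex.exp L)) fun m => ?_
    rw [TMode_eq_mode, M₄_eq_zero hp (hab.imp (fun h => hL.trans h.1) fun h => hL.trans h.1),
      add_zero, M₃_eq_mode]
  · refine quadraticRelation_of_pair hp hab (Or.inr rfl) (by rw [zpow_neg_one, hL, inv_inv])
      (p.q⁻¹ * (1 - p.q₁⁻¹ * Complex.exp L) * (1 - p.q₃⁻¹ * Complex.exp L)) fun m => ?_
    rw [TMode_eq_mode, M₃_eq_zero hp (hab.imp (fun h => by rw [hL, h.1]) fun h => by rw [hL, h.1]),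
      add_zero, M₄_eq_mode, neg_neg]

end FreeField

end

open FreeField
theorem mainTheorem2 (p : Params) (hp : p.Admissible) (L : ℂ) :
    ((Complex.exp L = p.q₁ ∨ Complex.exp L = p.q₁⁻¹) →
      QuadraticRelation (TMode p L) (structureSeries p p.q₁ p.q₃) (structureConst p p.q₁ p.q₃)
        p.q₂) ∧
    ((Complex.exp L = p.q₃ ∨ Complex.exp L = p.q₃⁻¹) →
      QuadraticRelation (TMode p L) (structureSeries p p.q₃ p.q₁) (structureConst p p.q₃ p.q₁)
        p.q₂) ∧
    ((Complex.exp L = p.q₁ ∨ Complex.exp L = p.q₃) →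
      ∀ e : ℚ, TCoeff p L 0 1 e = M₁ p L 0 1 e + M₂ p L 0 1 e + M₃ p L 0 1 (e - 2)) ∧
    ((Complex.exp L = p.q₁⁻¹ ∨ Complex.exp L = p.q₃⁻¹) →
      ∀ e : ℚ, TCoeff p L 0 1 e = M₁ p L 0 1 e + M₂ p L 0 1 e + M₄ p L 0 1 (e - 2)) := by
  refine ⟨fun hL => quadraticRelation_TMode hp (Or.inl ⟨rfl, rfl⟩) hL,
    fun hL => quadraticRelation_TMode hp (Or.inr ⟨rfl, rfl⟩) hL, fun hL e => ?_, fun hL e => ?_⟩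
  · rw [TCoeff, M₄_eq_zero hp hL, add_zero]
  · rw [TCoeff, M₃_eq_zero hp hL, add_zero]
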